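/- Let $\mathcal P=(S,\to,\mathit{IS},\mathit{AP},L)$ be a probabilistic automaton: $S$ is a finite set of states, $\to\ \subseteq S\times\mathit{Dist}(S)$ is a transition relation such that every state has at least one and at most finitely many outgoing transitions, $\mathit{IS}\subseteq S$, $\mathit{AP}$ is a set, and $L:S\to 2^{\mathit{AP}}$. *Schedulers.* A path is an infinite sequence $\omega=\omega[0]\omega[1]\dots$ of states such that for every $k$ there is $\omega[k]\to\mu$ with $\mu(\omega[k+1])>0$. A scheduler $\sigma$ maps every finite history $s_0\dots s_k$ to a probability distribution on the transitions leaving $s_k$. With a starting state $s$ it induces the probability measure $\mathrm{Prob}_{\sigma,s}$ on paths from $s$ under which, after the history $s_0\dots s_k$, the next state is $t$ with probability $\sum_{(s_k,\mu)\in\to}\sigma(s_0\dots s_k)(s_k,\mu)\cdot\mu(t)$. *Logic.* PCTL$^*$ state formulae $\varphi$ and path formulae $\psi$ are given by $$\varphi::=a\mid\varphi\wedge\varphi\mid\neg\varphi\mid\mathbb P_{\bowtie q}(\psi),\qquad \psi::=\varphi\mid\psi\wedge\psi\mid\neg\psi\mid\mathsf X\psi\mid\psi\,\mathsf U\,\psi,$$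 with $a\in\mathit{AP}$, $\bowtie\,\in\{<,>,\le,\ge\}$, $q\in[0,1]$. Path formulae are interpreted as in LTL (a state formula is evaluated at $\omega[0]$), $s\models a$ iff $a\in L(s)$, and $s\models\mathbb P_{\bowtie q}(\psi)$ iff $\mathrm{Prob}_{\sigma,s}(\{\omega\mid\omega\models\psi\})\bowtie q$ for every scheduler $\sigma$. The depth of an until-free path formula is the maximal nesting of $\mathsf X$: state formulae have depth $0$, $\wedge$ takes the maximum, $\neg$ preserves the depth, $\mathsf X$ adds $1$. PCTL$^{*-}_i$ consists of the until-free state formulae in which every path formula that occurs has depth at most $i$. Two states are equivalent for a logic if they satisfy the same state formulae of it. *Bisimulations.* For a pre-order $\mathcal R$ on $S$, a set $C\subseteq S$ is $\mathcal R$ downward closed if $C=\{s'\mid s'\,\mathcal R\,s\text{ for some }s\in C\}$. A pre-order $\mathcal R$ is a strong $1$-depth bisimulation if $s\,\mathcal R\,r$ implies $L(s)=L(r)$ and, for every $\mathcal R$ downward closed $C$: for each $s\to\mu$ with $\mu(C)>0$ there is $r\to\mu'$ with $\mu'(C)\ge\mu(C)$, and for each $r\to\mu$ with $\mu(C)>0$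 there is $s\to\mu'$ with $\mu'(C)\ge\mu(C)$. Write $s\sim_1 r$ if some strong $1$-depth bisimulation relates $s$ to $r$. An $\mathcal R$ downward closed path of length $n\ge1$ is a sequence $\Omega=C_0C_1\dots C_n$ of $\mathcal R$ downward closed sets. For a set $\tilde\Omega$ of such sequences, $C_{\tilde\Omega}$ is the set of paths $\omega$ for which there is $C_0\dots C_n\in\tilde\Omega$ with $\omega[k]\in C_k$ for all $0\le k\le n$, and $l(\tilde\Omega)$ is the maximal length of an element of $\tilde\Omega$. For $i>1$, a pre-order $\mathcal R$ is a strong $i$-depth bisimulation if $s\,\mathcal R\,r$ implies $s\sim_{i-1}r$ and, for every $\tilde\Omega$ with $l(\tilde\Omega)=i$: for each scheduler $\sigma$ with $\mathrm{Prob}_{\sigma,s}(C_{\tilde\Omega})>0$ there is a scheduler $\sigma'$ with $\mathrm{Prob}_{\sigma',r}(C_{\tilde\Omega})\ge\mathrm{Prob}_{\sigma,s}(C_{\tilde\Omega})$, and likewise with $s$ and $r$ exchanged. Write $s\sim_i r$ if some strong $i$-depth bisimulation relates $s$ to $r$, and let ${\sim}=\bigcap_{i\ge1}{\sim_i}$.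 **Theorem.** For every $i\ge1$, PCTL$^{*-}_i$ equivalence on $S$ coincides with $\sim_i$; moreover, PCTL$^*$ equivalence on $S$ coincides with $\sim$. -/

import Mathlib

open MeasureTheory ProbabilityTheory

universe u v

noncomputable section

/-- A probabilistic automaton `(S, →, IS, AP, L)`; `step` is the transition relation `→`, a set of
pairs of a state and a discrete probability distribution on states. It is image-finite. -/
structure ProbAutomaton (S : Type u) (AP : Type v) where
  step : Set (S × PMF S)
  init : Set S
  label : S → Set AP
  imageFinite : ∀ s, {μ | (s, μ) ∈ step}.Finite

namespace ProbAutomaton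

variable {S : Type u} {AP : Type v}

/-- The infinite paths `ω = ω[0] ω[1] …` that start in `s`. -/
def paths (P : ProbAutomaton S AP) (s : S) : Set (ℕ → S) :=
  {ω | ω 0 = s ∧ ∀ i, ∃ μ, (ω i, μ) ∈ P.step ∧ 0 < μ (ω (i + 1))}

/-- A (history-dependent, randomized) scheduler: given a finite history `h = s₀ … sₙ`, it chooses
a distribution over the transitions, supported by transitions that leave the last state `sₙ`. -/
structure Scheduler (P : ProbAutomaton S AP) where
  choice : (n : ℕ) → ((Finset.Iic n) → S) → PMF P.step
  source_eq : ∀ (n : ℕ) (h : (Finset.Iic n) → S) (t : P.step), 0 < choice n h t →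
    t.1.1 = h ⟨n, Finset.mem_Iic.2 le_rfl⟩

namespace Scheduler

variable {P : ProbAutomaton S AP}

/-- The distribution of the next state after the history `h`:
`s' ↦ ∑ over transitions (s, μ) of σ(h)(s, μ) · μ(s')`. -/
def next (σ : P.Scheduler) (n : ℕ) (h : (Finset.Iic n) → S) : PMF S :=
  (σ.choice n h).bind fun t => t.1.2

variable [Finite S] [MeasurableSpace S] [DiscreteMeasurableSpace S]

/-- The one-step kernels of a scheduler. -/
def kernel (σ : P.Scheduler) (n : ℕ) : Kernel ((i : Finset.Iic n) → (fun _ : ℕ => S) i) S :=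
  Kernel.ofFunOfCountable fun h => (σ.next n h).toMeasure

instance (σ : P.Scheduler) (n : ℕ) : IsMarkovKernel (σ.kernel n) :=
  ⟨fun h => PMF.toMeasure.isProbabilityMeasure (σ.next n h)⟩

/-- The probability measure on infinite state sequences induced by the scheduler `σ` and the
starting state `s` (Ionescu-Tulcea). -/
def measure (σ : P.Scheduler) (s : S) : Measure (ℕ → S) :=
  Kernel.traj (X := fun _ => S) σ.kernel 0 (fun _ => s)

end Scheduler

end ProbAutomaton

/-- The comparisons `<`, `>`, `≤`, `≥`. -/
inductive Comparison
  | lt | gt | le | ge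

/-- `c.holds x q` means `x ⋈ q`, where `⋈` is the comparison `c`. -/
def Comparison.holds : Comparison → ℝ → ℝ → Prop
  | .lt, x, q => x < q
  | .gt, x, q => x > q
  | .le, x, q => x ≤ q
  | .ge, x, q => x ≥ q

mutual

/-- PCTL* state formulae. -/
inductive StateFormula (AP : Type v) : Type v
  | atom (a : AP) : StateFormula AP
  | and (φ₁ φ₂ : StateFormula AP) : StateFormula AP
  | not (φ : StateFormula AP) : StateFormula AP
  | prob (c : Comparison) (q : Set.Icc (0 : ℝ) 1) (ψ : PathFormula AP) : StateFormula AP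

/-- PCTL* path formulae. -/
inductive PathFormula (AP : Type v) : Type v
  | state (φ : StateFormula AP) : PathFormula AP
  | and (ψ₁ ψ₂ : PathFormula AP) : PathFormula AP
  | not (ψ : PathFormula AP) : PathFormula AP
  | next (ψ : PathFormula AP) : PathFormula AP
  | until (ψ₁ ψ₂ : PathFormula AP) : PathFormula AP

end

/-- The number of nested next operators of a path formula. A state formula has depth `0`, whatever
occurs inside it. The depth is used for until-free formulae only. -/
def PathFormula.depth {AP : Type v} : PathFormula AP → ℕ
  | .state _ => 0
  | .and ψ₁ ψ₂ => max ψ₁.depth ψ₂.depth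
  | .not ψ => ψ.depth
  | .next ψ => 1 + ψ.depth
  | .until ψ₁ ψ₂ => max ψ₁.depth ψ₂.depth

mutual

/-- Membership of a state formula in the fragment of depth `i`: there is no until operator, and
every path formula that occurs has depth at most `i`. -/
def StateFormula.InFragment {AP : Type v} (i : ℕ) : StateFormula AP → Prop
  | .atom _ => True
  | .and φ₁ φ₂ => φ₁.InFragment i ∧ φ₂.InFragment i
  | .not φ => φ.InFragment i
  | .prob _ _ ψ => ψ.depth ≤ i ∧ ψ.InFragment i

/-- The path formula has no until operator, and every path formula that occurs in one of its state
subformulae has depth at most `i`. -/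
def PathFormula.InFragment {AP : Type v} (i : ℕ) : PathFormula AP → Prop
  | .state φ => φ.InFragment i
  | .and ψ₁ ψ₂ => ψ₁.InFragment i ∧ ψ₂.InFragment i
  | .not ψ => ψ.InFragment i
  | .next ψ => ψ.InFragment i
  | .until _ _ => False

end

namespace ProbAutomaton

variable {S : Type u} {AP : Type v}

section Satisfaction

variable [Finite S] [MeasurableSpace S] [DiscreteMeasurableSpace S]

mutual

/-- `s ⊨ φ` for a state formula. -/
def Sat (P : ProbAutomaton S AP) : StateFormula AP → S → Prop
  | .atom a, s => a ∈ P.label s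
  | .and φ₁ φ₂, s => P.Sat φ₁ s ∧ P.Sat φ₂ s
  | .not φ, s => ¬ P.Sat φ s
  | .prob c q ψ, s => ∀ σ : P.Scheduler,
      c.holds ((σ.measure s).real {ω | ω ∈ P.paths s ∧ P.PathSat ψ ω}) q

/-- `ω ⊨ ψ` for a path formula; `fun n => ω (j + n)` is the suffix of `ω` that starts at `ω[j]`. -/
def PathSat (P : ProbAutomaton S AP) : PathFormula AP → (ℕ → S) → Prop
  | .state φ, ω => P.Sat φ (ω 0)
  | .and ψ₁ ψ₂, ω => P.PathSat ψ₁ ω ∧ P.PathSat ψ₂ ω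
  | .not ψ, ω => ¬ P.PathSat ψ ω
  | .next ψ, ω => P.PathSat ψ (fun n => ω (1 + n))
  | .until ψ₁ ψ₂, ω => ∃ j, P.PathSat ψ₂ (fun n => ω (j + n)) ∧
      ∀ k < j, P.PathSat ψ₁ (fun n => ω (k + n))

end

/-- PCTL* equivalence of states. -/
def EquivPCTLStar (P : ProbAutomaton S AP) (s r : S) : Prop :=
  ∀ φ : StateFormula AP, P.Sat φ s ↔ P.Sat φ r

/-- Equivalence of states with respect to the until-free fragment of PCTL* of depth `i`. -/
def EquivFragment (P : ProbAutomaton S AP) (i : ℕ) (s r : S) : Prop :=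
  ∀ φ : StateFormula AP, φ.InFragment i → (P.Sat φ s ↔ P.Sat φ r)

end Satisfaction

/-- `C` is `R` downward closed: `C = {s' | s' R s for some s ∈ C}`. -/
def DownClosed (R : S → S → Prop) (C : Set S) : Prop :=
  C = {s' | ∃ s ∈ C, R s' s}

/-- A pre-order `R` is a strong 1-depth bisimulation. -/
structure IsOneDepthBisim (P : ProbAutomaton S AP) (R : S → S → Prop) : Prop where
  preorder : IsPreorder S R
  label_eq : ∀ s r, R s r → P.label s = P.label r
  forth : ∀ s r, R s r → ∀ C, DownClosed R C → ∀ μ : PMF S, (s, μ) ∈ P.step →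
    0 < μ.toOuterMeasure C →
      ∃ μ' : PMF S, (r, μ') ∈ P.step ∧ μ'.toOuterMeasure C ≥ μ.toOuterMeasure C
  back : ∀ s r, R s r → ∀ C, DownClosed R C → ∀ μ : PMF S, (r, μ) ∈ P.step →
    0 < μ.toOuterMeasure C →
      ∃ μ' : PMF S, (s, μ') ∈ P.step ∧ μ'.toOuterMeasure C ≥ μ.toOuterMeasure C

/-- A finite sequence `C₀ C₁ … Cₙ` of sets of states; its length `n` is the number of steps. -/
abbrev SetPath (S : Type u) : Type u := Σ n : ℕ, Fin (n + 1) → Set S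

/-- The `R` downward closed paths of arbitrary length `n ≥ 1`. -/
def closedSetPaths (R : S → S → Prop) : Set (SetPath S) :=
  {Ω | 1 ≤ Ω.1 ∧ ∀ k, DownClosed R (Ω.2 k)}

/-- The union of the cones of a set of set-paths: the paths `ω` from `s` such that, for some
`C₀ … Cₙ` in the set, `ω[k] ∈ Cₖ` for all `k ≤ n`. -/
def coneFrom (P : ProbAutomaton S AP) (s : S) (Ωs : Set (SetPath S)) : Set (ℕ → S) :=
  {ω | ω ∈ P.paths s ∧ ∃ Ω ∈ Ωs, ∀ k : Fin (Ω.1 + 1), ω k ∈ Ω.2 k}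

section Bisimulation

variable [Finite S] [MeasurableSpace S] [DiscreteMeasurableSpace S]

/-- A pre-order `R` is a strong `i`-depth bisimulation over the relation `prev` (which is
`(i-1)`-depth bisimilarity). -/
structure IsDepthBisim (P : ProbAutomaton S AP) (i : ℕ) (prev : S → S → Prop)
    (R : S → S → Prop) : Prop where
  preorder : IsPreorder S R
  le_prev : ∀ s r, R s r → prev s r
  forth : ∀ s r, R s r → ∀ Ωs ⊆ closedSetPaths R, IsGreatest (Sigma.fst '' Ωs) i →
    ∀ σ : P.Scheduler, 0 < (σ.measure s).real (P.coneFrom s Ωs) →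
      ∃ σ' : P.Scheduler,
        (σ'.measure r).real (P.coneFrom r Ωs) ≥ (σ.measure s).real (P.coneFrom s Ωs)
  back : ∀ s r, R s r → ∀ Ωs ⊆ closedSetPaths R, IsGreatest (Sigma.fst '' Ωs) i →
    ∀ σ : P.Scheduler, 0 < (σ.measure r).real (P.coneFrom r Ωs) →
      ∃ σ' : P.Scheduler,
        (σ'.measure s).real (P.coneFrom s Ωs) ≥ (σ.measure r).real (P.coneFrom r Ωs)

/-- Strong `i`-depth bisimilarity `~ᵢ` for `i ≥ 1` (the value at `0` is a dummy: it is never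
used, neither in the recursion nor in the intersection below). -/
def DepthBisimilar (P : ProbAutomaton S AP) : ℕ → S → S → Prop
  | 0 => fun _ _ => True
  | 1 => fun s r => ∃ R, P.IsOneDepthBisim R ∧ R s r
  | i + 2 => fun s r => ∃ R, P.IsDepthBisim (i + 2) (P.DepthBisimilar (i + 1)) R ∧ R s r

/-- Strong bisimilarity `~`, the intersection of all `~ᵢ` with `i ≥ 1`. -/
def StrongBisimilar (P : ProbAutomaton S AP) (s r : S) : Prop :=
  ∀ i ≥ 1, P.DepthBisimilar i s r

end Bisimulation

end ProbAutomaton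

end

noncomputable section

namespace ProbAutomaton

variable {S : Type u} {AP : Type v}

/-- The states visited after the initial one, up to time `n`. -/
def word (ω : ℕ → S) (n : ℕ) : List S := List.ofFn fun k : Fin n => ω (k + 1)

/-- The path that starts at time `1`. -/
def tail (ω : ℕ → S) : ℕ → S := fun n => ω (1 + n)

@[simp] lemma word_zero (ω : ℕ → S) : word ω 0 = [] := rfl

@[simp] lemma length_word (ω : ℕ → S) (n : ℕ) : (word ω n).length = n := by simp [word]

lemma word_succ (ω : ℕ → S) (n : ℕ) : word ω (n + 1) = word ω n ++ [ω (n + 1)] := by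
  rw [word, List.ofFn_succ_last]; simp [word]

lemma word_succ_cons (ω : ℕ → S) (n : ℕ) : word ω (n + 1) = ω 1 :: word (tail ω) n := by
  rw [word, List.ofFn_succ]
  simp [word, tail, add_comm]

lemma word_eq_word_iff {ω ω' : ℕ → S} {n : ℕ} :
    word ω n = word ω' n ↔ ∀ k < n, ω (k + 1) = ω' (k + 1) := by
  simp only [word, List.ofFn_inj, funext_iff]
  exact ⟨fun h k hk => h ⟨k, hk⟩, fun h k => h k k.2⟩

/-- The list of states of a finite history after the initial one. -/
def historyWord {n : ℕ} (h : Finset.Iic n → S) : List S :=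
  List.ofFn fun k : Fin n => h ⟨k + 1, Finset.mem_Iic.2 k.2⟩

lemma historyWord_frestrictLe (ω : ℕ → S) (n : ℕ) :
    historyWord (Preorder.frestrictLe (π := fun _ => S) n ω) = word ω n := rfl

lemma getLast_cons_word (ω : ℕ → S) (n : ℕ) :
    (ω 0 :: word ω n).getLast (List.cons_ne_nil _ _) = ω n := by
  cases n with
  | zero => rfl
  | succ n => simp [word_succ]

namespace Scheduler

variable {P : ProbAutomaton S AP}

lemma exists_step_of_next_pos (σ : P.Scheduler) {n : ℕ} {h : Finset.Iic n → S} {t : S}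
    (ht : 0 < σ.next n h t) :
    ∃ μ : PMF S, (h ⟨n, Finset.mem_Iic.2 le_rfl⟩, μ) ∈ P.step ∧ 0 < μ t := by
  have ht' : t ∈ ((σ.choice n h).bind fun a => a.1.2).support := ht.ne'
  rw [PMF.mem_support_bind_iff] at ht'
  obtain ⟨a, ha, hat⟩ := ht'
  refine ⟨a.1.2, ?_, pos_iff_ne_zero.2 hat⟩
  rw [← σ.source_eq n h a (pos_iff_ne_zero.2 ha)]
  exact a.2

/-- Some transition that leaves the last state does at least as well as the mixture chosen by the
scheduler. -/
lemma exists_step_tsum_le (σ : P.Scheduler) (n : ℕ) (h : Finset.Iic n → S) (f : S → ENNReal)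
    [Fintype S] :
    ∃ μ : PMF S, (h ⟨n, Finset.mem_Iic.2 le_rfl⟩, μ) ∈ P.step ∧
      ∑ t, σ.next n h t * f t ≤ ∑ t, μ t * f t := by
  set p := σ.choice n h
  have hsum : ∑ t, σ.next n h t * f t = ∑' a, p a * ∑ t, a.1.2 t * f t := by
    simp only [Scheduler.next, PMF.bind_apply, ← ENNReal.tsum_mul_right, Finset.mul_sum, p]
    rw [← tsum_fintype (L := .unconditional S), ENNReal.tsum_comm]
    simp [tsum_fintype, mul_assoc]
  set K := {μ | (h ⟨n, Finset.mem_Iic.2 le_rfl⟩, μ) ∈ P.step}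
  have hmem : ∀ a ∈ p.support, a.1.2 ∈ K := fun a ha => by
    have := σ.source_eq n h a (pos_iff_ne_zero.2 ha)
    change (_, _) ∈ P.step
    rw [← this]; exact a.2
  obtain ⟨a₀, ha₀⟩ := p.support_nonempty
  obtain ⟨μ, hμ, hmax⟩ := Set.exists_max_image K (fun μ => ∑ t, μ t * f t) (P.imageFinite _)
    ⟨_, hmem a₀ ha₀⟩
  refine ⟨μ, hμ, hsum.trans_le ?_⟩
  calc ∑' a, p a * ∑ t, a.1.2 t * f t ≤ ∑' a, p a * ∑ t, μ t * f t := by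
        refine ENNReal.tsum_le_tsum fun a => ?_
        by_cases ha : a ∈ p.support
        · exact mul_le_mul_right (hmax _ (hmem a ha)) _
        · simp [(PMF.apply_eq_zero_iff p a).2 ha]
    _ = _ := by rw [ENNReal.tsum_mul_right, p.tsum_coe, one_mul]

/-- The deterministic scheduler that follows a choice of a transition after each history. -/
def ofAct (act : (n : ℕ) → (Finset.Iic n → S) → PMF S)
    (hact : ∀ n h, (h ⟨n, Finset.mem_Iic.2 le_rfl⟩, act n h) ∈ P.step) : P.Scheduler where
  choice n h := PMF.pure ⟨(h ⟨n, Finset.mem_Iic.2 le_rfl⟩, act n h), hact n h⟩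
  source_eq n h t ht := by
    have : t ∈ (PMF.pure (⟨(h ⟨n, Finset.mem_Iic.2 le_rfl⟩, act n h), hact n h⟩ :
      P.step)).support := ht.ne'
    rw [PMF.mem_support_pure_iff] at this
    rw [this]

lemma next_ofAct (act : (n : ℕ) → (Finset.Iic n → S) → PMF S)
    (hact : ∀ n h, (h ⟨n, Finset.mem_Iic.2 le_rfl⟩, act n h) ∈ P.step) (n : ℕ)
    (h : Finset.Iic n → S) : (ofAct act hact).next n h = act n h :=
  PMF.pure_bind _ _

section

variable [Finite S] [MeasurableSpace S] [DiscreteMeasurableSpace S]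

instance (σ : P.Scheduler) (s : S) : IsProbabilityMeasure (σ.measure s) := by
  unfold Scheduler.measure; infer_instance

lemma measure_frestrictLe_inter (σ : P.Scheduler) (s : S) (n : ℕ) (h : Finset.Iic n → S) (t : S) :
    σ.measure s {ω | Preorder.frestrictLe (π := fun _ => S) n ω = h ∧ ω (n + 1) = t} =
      σ.measure s {ω | Preorder.frestrictLe (π := fun _ => S) n ω = h} * σ.next n h t := by
  have hm : Measurable (fun ω : ℕ → S => (Preorder.frestrictLe (π := fun _ => S) n ω, ω)) := by
    fun_prop
  have ht : MeasurableSet {ω : ℕ → S | ω (n + 1) = t} :=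
    (MeasurableSet.singleton t).preimage (measurable_pi_apply (n + 1))
  have hs : MeasurableSet ({h} ×ˢ {ω : ℕ → S | ω (n + 1) = t} :
      Set ((Finset.Iic n → S) × (ℕ → S))) := (MeasurableSet.singleton h).prod ht
  have key := Kernel.partialTraj_compProd_traj (X := fun _ => S) (κ := σ.kernel) (Nat.zero_le n)
    (fun _ => s)
  have h1 := congrArg (fun m => m ({h} ×ˢ {ω : ℕ → S | ω (n + 1) = t})) key
  rw [Measure.map_apply hm hs, Measure.compProd_apply_prod (MeasurableSet.singleton h) ht] at h1
  have h2 : Kernel.traj (X := fun _ => S) σ.kernel n h {ω : ℕ → S | ω (n + 1) = t} =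
      σ.next n h t := by
    have := congrArg (fun k : Kernel (Finset.Iic n → S) S => k h {t})
      (Kernel.map_traj_succ_self (X := fun _ => S) (κ := σ.kernel) (a := n))
    rw [Kernel.map_apply' _ (measurable_pi_apply (n + 1)) _ (MeasurableSet.singleton t)] at this
    refine this.trans ?_
    exact PMF.toMeasure_apply_singleton _ _ (MeasurableSet.singleton t)
  rw [Measure.restrict_singleton, lintegral_smul_measure, lintegral_dirac, h2,
    ← Kernel.traj_map_frestrictLe_apply, Measure.map_apply (by fun_prop) (by simp)] at h1
  exact h1.symm

lemma ae_zero_eq (σ : P.Scheduler) (s : S) : ∀ᵐ ω ∂σ.measure s, ω 0 = s := by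
  have h : (σ.measure s).map (Preorder.frestrictLe (π := fun _ => S) 0) =
      Measure.dirac (fun _ => s) := by
    rw [Scheduler.measure, Kernel.traj_map_frestrictLe_apply, Kernel.partialTraj_self,
      Kernel.id_apply]
  have h' : ∀ᵐ x ∂(σ.measure s).map (Preorder.frestrictLe (π := fun _ => S) 0),
      x ⟨0, Finset.mem_Iic.2 le_rfl⟩ = s := by
    rw [h, ae_dirac_iff (p := fun x : Finset.Iic 0 → S => x ⟨0, Finset.mem_Iic.2 le_rfl⟩ = s)
      ((MeasurableSet.singleton s).preimage (measurable_pi_apply _))]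
  exact ae_of_ae_map (by fun_prop) h'

lemma ae_next_pos (σ : P.Scheduler) (s : S) (n : ℕ) : ∀ᵐ ω ∂σ.measure s,
    0 < σ.next n (Preorder.frestrictLe (π := fun _ => S) n ω) (ω (n + 1)) := by
  rw [ae_iff]
  have : {ω : ℕ → S | ¬ 0 < σ.next n (Preorder.frestrictLe (π := fun _ => S) n ω) (ω (n + 1))} ⊆
      ⋃ p ∈ {p : (Finset.Iic n → S) × S | σ.next n p.1 p.2 = 0},
        {ω : ℕ → S | Preorder.frestrictLe (π := fun _ => S) n ω = p.1 ∧ ω (n + 1) = p.2} := by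
    intro ω hω
    simp only [Set.mem_iUnion]
    exact ⟨(_, _), not_lt.1 hω |>.antisymm zero_le, rfl, rfl⟩
  refine measure_mono_null this ((measure_biUnion_null_iff (Set.to_countable _)).2 fun p hp => ?_)
  rw [measure_frestrictLe_inter, hp, mul_zero]

lemma ae_mem_paths (σ : P.Scheduler) (s : S) : ∀ᵐ ω ∂σ.measure s, ω ∈ P.paths s := by
  filter_upwards [σ.ae_zero_eq s, ae_all_iff.2 (σ.ae_next_pos s)] with ω h0 h1
  exact ⟨h0, fun i => σ.exists_step_of_next_pos (h1 i)⟩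

lemma measure_paths_inter (σ : P.Scheduler) (s : S) (A : Set (ℕ → S)) :
    σ.measure s {ω | ω ∈ P.paths s ∧ ω ∈ A} = σ.measure s A := by
  refine measure_congr ?_
  filter_upwards [σ.ae_mem_paths s] with ω h
  exact propext (and_iff_right h)

end

end Scheduler

open Filter

section Measure

variable [Fintype S] [MeasurableSpace S] [DiscreteMeasurableSpace S]

/-- A measurable set of sequences contains sets of almost the same measure that are closed: they
contain every sequence all of whose prefixes they extend. -/
lemma exists_prefixClosed_lt (ν : Measure (ℕ → S)) [IsFiniteMeasure ν] {A : Set (ℕ → S)}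
    (hA : MeasurableSet A) {c : ENNReal} (hc : c < ν A) :
    ∃ K ⊆ A, MeasurableSet K ∧ c < ν K ∧
      ∀ ω, (∀ n, ∃ ω' ∈ K, ∀ k ≤ n, ω' k = ω k) → ω ∈ K := by
  let _ : TopologicalSpace S := ⊥
  have : DiscreteTopology S := ⟨rfl⟩
  obtain ⟨K, hKA, hK, hcK⟩ := hA.exists_lt_isClosed_of_ne_top (measure_ne_top ν A) hc
  refine ⟨K, hKA, hK.measurableSet, hcK, fun ω hω => ?_⟩
  choose x hxK hx using hω
  refine hK.mem_of_tendsto (f := x) (b := atTop) ?_ (Eventually.of_forall hxK)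
  refine tendsto_pi_nhds.2 fun k => ?_
  refine tendsto_const_nhds.congr' ?_
  filter_upwards [eventually_ge_atTop k] with n hn using (hx n k hn).symm

lemma integrable_of_frestrictLe (ν : Measure (ℕ → S)) [IsFiniteMeasure ν] (n : ℕ)
    (f : (Finset.Iic n → S) → ℝ) :
    Integrable (fun ω => f (Preorder.frestrictLe (π := fun _ => S) n ω)) ν :=
  Integrable.comp_measurable (f := Preorder.frestrictLe (π := fun _ => S) n)
    (Integrable.of_finite) (by fun_prop)

lemma measurableSet_word (n : ℕ) (B : Set (List S)) : MeasurableSet {ω : ℕ → S | word ω n ∈ B} :=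
  (Set.toFinite {h : Finset.Iic n → S | historyWord h ∈ B}).measurableSet.preimage
    (Preorder.measurable_frestrictLe (X := fun _ => S) n)

lemma integrable_word (ν : Measure (ℕ → S)) [IsFiniteMeasure ν] (n : ℕ) (f : List S → ℝ) :
    Integrable (fun ω => f (word ω n)) ν :=
  integrable_of_frestrictLe ν n fun h => f (historyWord h)

variable {P : ProbAutomaton S AP}

lemma Scheduler.integral_next (σ : P.Scheduler) (s : S) (n : ℕ)
    (f : (Finset.Iic n → S) → S → ℝ) :
    ∫ ω, f (Preorder.frestrictLe (π := fun _ => S) n ω) (ω (n + 1)) ∂σ.measure s =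
      ∫ ω, ∑ t, (σ.next n (Preorder.frestrictLe (π := fun _ => S) n ω) t).toReal *
        f (Preorder.frestrictLe (π := fun _ => S) n ω) t ∂σ.measure s := by
  have hm : Measurable (fun ω : ℕ → S =>
      (Preorder.frestrictLe (π := fun _ => S) n ω, ω (n + 1))) := by fun_prop
  have hm' : Measurable (Preorder.frestrictLe (π := fun _ => S) n) := by fun_prop
  have h1 := integral_map (μ := σ.measure s) hm.aemeasurable
    (f := fun p : (Finset.Iic n → S) × S => f p.1 p.2) (by fun_prop)
  have h2 := integral_map (μ := σ.measure s) hm'.aemeasurable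
    (f := fun h : Finset.Iic n → S => ∑ t, (σ.next n h t).toReal * f h t) (by fun_prop)
  rw [← h1, ← h2, integral_fintype (hf := Integrable.of_finite),
    integral_fintype (hf := Integrable.of_finite), Fintype.sum_prod_type]
  refine Finset.sum_congr rfl fun h _ => ?_
  rw [smul_eq_mul, Finset.mul_sum]
  refine Finset.sum_congr rfl fun t _ => ?_
  rw [smul_eq_mul, ← mul_assoc, measureReal_def, measureReal_def,
    Measure.map_apply hm (measurableSet_singleton _),
    Measure.map_apply hm' (measurableSet_singleton _), ← ENNReal.toReal_mul]
  have := σ.measure_frestrictLe_inter s n h t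
  have e1 : ((fun ω : ℕ → S => (Preorder.frestrictLe (π := fun _ => S) n ω, ω (n + 1))) ⁻¹'
      {(h, t)}) = {ω | Preorder.frestrictLe (π := fun _ => S) n ω = h ∧ ω (n + 1) = t} := by
    ext ω; exact Prod.mk_inj
  rw [e1, this]
  rfl

end Measure

section Controller

variable {P : ProbAutomaton S AP} {M : Type*}

lemma cur_foldl {upd : M → S → M} {cur : M → S} (hupd : ∀ m t, cur (upd m t) = t) (m : M)
    (w : List S) : cur (w.foldl upd m) = (cur m :: w).getLast (List.cons_ne_nil _ _) := by
  induction w generalizing m with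
  | nil => rfl
  | cons t w ih =>
    rw [List.foldl_cons, ih, List.getLast_cons (List.cons_ne_nil t w)]
    simp only [hupd]

/-- A controller with memory `M` yields a scheduler. Functions of the memory that do not decrease
in expectation under the controller do not decrease in expectation under the scheduler. -/
lemma exists_scheduler_of_controller [Fintype S] [MeasurableSpace S] [DiscreteMeasurableSpace S]
    (serial : ∀ s, ∃ μ : PMF S, (s, μ) ∈ P.step)
    (upd : M → S → M) (act : M → PMF S) (cur : M → S) (hact : ∀ m, (cur m, act m) ∈ P.step)
    (hupd : ∀ m t, cur (upd m t) = t) (m₀ : M) :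
    ∃ σ : P.Scheduler, ∀ f : M → ℝ, (∀ m, f m ≤ ∑ t, (act m t).toReal * f (upd m t)) →
      ∀ n, f m₀ ≤ ∫ ω, f ((word ω n).foldl upd m₀) ∂σ.measure (cur m₀) := by
  classical
  choose d hd using serial
  let run {n : ℕ} (h : Finset.Iic n → S) : M := (historyWord h).foldl upd m₀
  let σ : P.Scheduler := Scheduler.ofAct
    (fun n h => if cur (run h) = h ⟨n, Finset.mem_Iic.2 le_rfl⟩ then act (run h) else
      d (h ⟨n, Finset.mem_Iic.2 le_rfl⟩)) (fun n h => by
      split_ifs with hh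
      · rw [← hh]; exact hact _
      · exact hd _)
  refine ⟨σ, fun f hf n => ?_⟩
  induction n with
  | zero => simp
  | succ n ih =>
    refine ih.trans ?_
    have h1 := σ.integral_next (cur m₀) n fun h t => f (upd (run h) t)
    have h2 : ∀ ω : ℕ → S, (word ω (n + 1)).foldl upd m₀ =
        upd (run (Preorder.frestrictLe (π := fun _ => S) n ω)) (ω (n + 1)) := fun ω => by
      rw [word_succ, List.foldl_append]; rfl
    simp only [h2]
    rw [h1]
    refine integral_mono_ae (integrable_word _ n fun w => f (w.foldl upd m₀))
      (integrable_of_frestrictLe _ n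
        fun h => ∑ t, (σ.next n h t).toReal * f (upd (run h) t)) ?_
    filter_upwards [σ.ae_zero_eq (cur m₀)] with ω hω
    have h3 : cur (run (Preorder.frestrictLe (π := fun _ => S) n ω)) = ω n := by
      refine (cur_foldl hupd m₀ _).trans ?_
      rw [historyWord_frestrictLe, ← getLast_cons_word ω n]
      simp only [hω]
    have h4 : σ.next n (Preorder.frestrictLe (π := fun _ => S) n ω) =
        act (run (Preorder.frestrictLe (π := fun _ => S) n ω)) := by
      rw [Scheduler.next_ofAct]
      exact if_pos h3
    rw [h4]
    exact hf _

end Controller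

section Certificate

/-- The sequence `s, ω[0], ω[1], …`. -/
def consPath (s : S) (ω : ℕ → S) : ℕ → S
  | 0 => s
  | n + 1 => ω n

@[simp] lemma tail_consPath (s : S) (ω : ℕ → S) : tail (consPath s ω) = ω := by
  funext n; simp [tail, add_comm 1 n, consPath]

lemma word_consPath (s : S) (ω : ℕ → S) (n : ℕ) :
    word (consPath s ω) (n + 1) = ω 0 :: word ω n := by
  rw [word_succ_cons, tail_consPath]; rfl

variable [Fintype S]

/-- A certificate that event `A` can be achieved from state `s` with probability at least `g []`:
`act` is a deterministic scheduler and `g` a potential, both indexed by the states visited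
after `s`. -/
structure IsCertificate (P : ProbAutomaton S AP) (s : S) (A : Set (ℕ → S)) (g : List S → ℝ)
    (act : List S → PMF S) : Prop where
  nonneg : ∀ w, 0 ≤ g w
  le_one : ∀ w, g w ≤ 1
  step : ∀ w, ((s :: w).getLast (List.cons_ne_nil _ _), act w) ∈ P.step
  le_sum : ∀ w, g w ≤ ∑ t, (act w t).toReal * g (w ++ [t])
  mem : ∀ ω : ℕ → S, ω 0 = s → (∃ᶠ n in atTop, 0 < g (word ω n)) → ω ∈ A

variable {P : ProbAutomaton S AP}

lemma IsCertificate.mono {s : S} {A B : Set (ℕ → S)} {g : List S → ℝ} {act : List S → PMF S}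
    (h : P.IsCertificate s A g act) (hAB : A ⊆ B) : P.IsCertificate s B g act :=
  { h with mem := fun ω h0 hω => hAB (h.mem ω h0 hω) }

lemma exists_isCertificate_zero (serial : ∀ s, ∃ μ : PMF S, (s, μ) ∈ P.step) (s : S)
    (A : Set (ℕ → S)) : ∃ act, P.IsCertificate s A (fun _ => 0) act := by
  choose d hd using serial
  exact ⟨fun w => d _, fun _ => le_rfl, fun _ => zero_le_one, fun w => hd _, by simp, by simp⟩

lemma IsCertificate.shift {s : S} {A : Set (ℕ → S)} {g : List S → ℝ} {act : List S → PMF S}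
    (h : P.IsCertificate s A g act) (t : S) :
    P.IsCertificate t {ω | consPath s ω ∈ A} (fun w => g (t :: w)) (fun w => act (t :: w)) where
  nonneg w := h.nonneg _
  le_one w := h.le_one _
  step w := by
    have := h.step (t :: w)
    rwa [List.getLast_cons (List.cons_ne_nil t w)] at this
  le_sum w := h.le_sum (t :: w)
  mem ω hω hf := by
    refine h.mem _ rfl ?_
    rw [frequently_atTop] at hf ⊢
    intro N
    obtain ⟨n, hn, hpos⟩ := hf N
    exact ⟨n + 1, by omega, by rwa [word_consPath, hω]⟩

variable [MeasurableSpace S] [DiscreteMeasurableSpace S]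

lemma exists_isCertificate_of_lt (serial : ∀ s, ∃ μ : PMF S, (s, μ) ∈ P.step) (σ : P.Scheduler)
    (s : S) {A : Set (ℕ → S)} (hA : MeasurableSet A) {c : ℝ} (hc0 : 0 ≤ c)
    (hc : ENNReal.ofReal c < σ.measure s A) :
    ∃ g act, P.IsCertificate s A g act ∧ c < g [] ∧
      ∀ w, 0 < g w → ∃ ω ∈ A, ω 0 = s ∧ word ω w.length = w := by
  classical
  obtain ⟨K, hKA, hKm, hcK, hK⟩ := exists_prefixClosed_lt (σ.measure s) hA hc
  let C (w : List S) : Set (ℕ → S) := {ω | word ω w.length = w}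
  have hCm (w) : MeasurableSet (C w) := measurableSet_word w.length {w}
  let G (w : List S) : ENNReal := σ.measure s (K ∩ C w) / σ.measure s (C w)
  have hG1 (w) : G w ≤ 1 := ENNReal.div_le_of_le_mul (by
    rw [one_mul]; exact measure_mono Set.inter_subset_right)
  have hGt (w) : G w ≠ ⊤ := ((hG1 w).trans_lt ENNReal.one_lt_top).ne
  have hC_iff (w : List S) (t : S) (ω : ℕ → S) :
      ω ∈ C (w ++ [t]) ↔ ω ∈ C w ∧ ω (w.length + 1) = t := by
    change word ω (w ++ [t]).length = _ ↔ word ω _ = _ ∧ _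
    rw [List.length_append, List.length_singleton, word_succ]
    constructor
    · intro h
      have := List.append_inj' h rfl
      exact ⟨this.1, by simpa using this.2⟩
    · rintro ⟨h1, h2⟩
      rw [h1, h2]
  have hsplit (w : List S) (B : Set (ℕ → S)) (hB : MeasurableSet B) :
      σ.measure s (B ∩ C w) = ∑ t, σ.measure s (B ∩ C (w ++ [t])) := by
    have : B ∩ C w = ⋃ t ∈ (Finset.univ : Finset S), B ∩ C (w ++ [t]) := by
      ext ω
      simp only [Set.mem_iUnion, Set.mem_inter_iff, hC_iff]
      exact ⟨fun h => ⟨_, Finset.mem_univ _, h.1, h.2, rfl⟩, fun ⟨t, _, h⟩ => ⟨h.1, h.2.1⟩⟩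
    rw [this, measure_biUnion_finset _ fun t _ => hB.inter (hCm _)]
    intro t _ t' _ htt'
    refine Set.disjoint_left.2 fun ω h h' => htt' ?_
    exact (((hC_iff w t ω).1 h.2).2).symm.trans (((hC_iff w t' ω).1 h'.2).2)
  have hpos {w : List S} (hw : G w ≠ 0) : σ.measure s (K ∩ C w) ≠ 0 := fun h => hw (by
    simp only [G, h, ENNReal.zero_div])
  have hex {w : List S} (hw : σ.measure s (K ∩ C w) ≠ 0) : ∃ ω ∈ K, ω 0 = s ∧ ω ∈ C w := by
    have : ∃ᵐ ω ∂σ.measure s, ω ∈ K ∩ C w := by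
      intro h; exact hw (by rw [ae_iff] at h; simpa using h)
    obtain ⟨ω, h1, h2⟩ := (this.and_eventually (σ.ae_zero_eq s)).exists
    exact ⟨ω, h1.1, h2, h1.2⟩
  have hstep (w : List S) : ∃ μ : PMF S, ((s :: w).getLast (List.cons_ne_nil _ _), μ) ∈ P.step ∧
      G w ≤ ∑ t, μ t * G (w ++ [t]) := by
    by_cases hw : G w = 0
    · obtain ⟨μ, hμ⟩ := serial ((s :: w).getLast (List.cons_ne_nil _ _))
      exact ⟨μ, hμ, by simp [hw]⟩
    obtain ⟨ω₀, -, h0, hω₀⟩ := hex (hpos hw)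
    set n := w.length
    set h := Preorder.frestrictLe (π := fun _ => S) n ω₀
    have hh : ∀ ω : ℕ → S, ω 0 = s →
        (Preorder.frestrictLe (π := fun _ => S) n ω = h ↔ ω ∈ C w) := by
      intro ω hω
      have : ω ∈ C w ↔ word ω n = word ω₀ n := by
        change word ω n = w ↔ _
        rw [show word ω₀ n = w from hω₀]
      rw [this, word_eq_word_iff, funext_iff]
      constructor
      · exact fun H k hk => H ⟨k + 1, Finset.mem_Iic.2 hk⟩
      · rintro H ⟨k, hk⟩
        cases k with
        | zero => exact hω.trans h0.symm
        | succ k => exact H k (Finset.mem_Iic.1 hk)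
    have e1 : σ.measure s {ω | Preorder.frestrictLe (π := fun _ => S) n ω = h} =
        σ.measure s (C w) := by
      refine measure_congr ?_
      filter_upwards [σ.ae_zero_eq s] with ω hω
      exact propext (hh ω hω)
    have e2 (t : S) : σ.measure s (C (w ++ [t])) = σ.measure s (C w) * σ.next n h t := by
      rw [← e1, ← σ.measure_frestrictLe_inter]
      refine measure_congr ?_
      filter_upwards [σ.ae_zero_eq s] with ω hω
      exact propext ((hC_iff w t ω).trans (and_congr_left' (hh ω hω).symm))
    obtain ⟨μ, hμ, hle⟩ := σ.exists_step_tsum_le n h fun t => G (w ++ [t])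
    refine ⟨μ, ?_, le_trans ?_ hle⟩
    · have : h ⟨n, Finset.mem_Iic.2 le_rfl⟩ = ω₀ n := rfl
      rw [this, ← getLast_cons_word ω₀ n] at hμ
      simp only [h0, show word ω₀ n = w from hω₀] at hμ
      exact hμ
    · simp only [G]
      rw [hsplit w K hKm, div_eq_mul_inv, Finset.sum_mul]
      refine Finset.sum_le_sum fun t _ => ?_
      rw [e2]
      by_cases ht : σ.next n h t = 0
      · have : σ.measure s (K ∩ C (w ++ [t])) = 0 :=
          measure_mono_null Set.inter_subset_right (by rw [e2, ht, mul_zero])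
        simp [this]
      · rw [div_eq_mul_inv, ENNReal.mul_inv (Or.inr (PMF.apply_ne_top _ _)) (Or.inr ht),
          mul_comm (σ.next n h t), mul_assoc, mul_assoc, ENNReal.inv_mul_cancel ht
          (PMF.apply_ne_top _ _), mul_one]
  choose act hact hle using hstep
  have hpos' {w : List S} (hw : 0 < (G w).toReal) : ∃ ω ∈ K, ω 0 = s ∧ ω ∈ C w :=
    hex (hpos fun h => by simp [h] at hw)
  refine ⟨fun w => (G w).toReal, act, ⟨fun w => ENNReal.toReal_nonneg,
    fun w => ENNReal.toReal_le_of_le_ofReal zero_le_one (by simpa using hG1 w), hact,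
    fun w => ?_, fun ω hω hf => hKA (hK ω fun n => ?_)⟩, ?_, fun w hw => ?_⟩
  · have := ENNReal.toReal_mono (ENNReal.sum_ne_top.2 fun t _ =>
      ENNReal.mul_ne_top (PMF.apply_ne_top _ _) (hGt _)) (hle w)
    rw [ENNReal.toReal_sum fun t _ => ENNReal.mul_ne_top (PMF.apply_ne_top _ _) (hGt _)] at this
    simpa only [ENNReal.toReal_mul] using this
  · obtain ⟨m, hm, hmpos⟩ := (frequently_atTop.1 hf) n
    obtain ⟨ω', h1, h2, h3⟩ := hpos' hmpos
    refine ⟨ω', h1, fun k hk => ?_⟩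
    cases k with
    | zero => rw [h2, hω]
    | succ k =>
      have : word ω' m = word ω m := by
        have h3' : word ω' (word ω m).length = word ω m := h3
        rwa [length_word] at h3'
      exact word_eq_word_iff.1 this k (by omega)
  · have h1 : C [] = Set.univ := Set.eq_univ_of_forall fun ω => rfl
    have h2 : G [] = σ.measure s K := by simp [G, h1]
    change c < (G []).toReal
    rw [h2]
    exact (ENNReal.ofReal_lt_iff_lt_toReal hc0 (measure_ne_top _ _)).1 hcK
  · obtain ⟨ω', h1, h2, h3⟩ := hpos' hw
    exact ⟨ω', hKA h1, h2, h3⟩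

end Certificate

section Attainment

lemma le_measure_frequently [MeasurableSpace S] {ν : Measure (ℕ → S)} [IsFiniteMeasure ν]
    {B : ℕ → Set (ℕ → S)} (hB : ∀ n, MeasurableSet (B n)) {c : ENNReal} (hc : ∀ n, c ≤ ν (B n)) :
    c ≤ ν {ω | ∃ᶠ n in atTop, ω ∈ B n} := by
  have h : {ω | ∃ᶠ n in atTop, ω ∈ B n} = ⋂ N, ⋃ n ≥ N, B n := by
    ext ω
    simp only [frequently_atTop, Set.mem_iInter, Set.mem_iUnion, exists_prop]
    rfl
  rw [h]
  refine ge_of_tendsto' (tendsto_measure_iInter_atTop (fun N => ?_) ?_ ⟨0, measure_ne_top _ _⟩)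
    fun N => (hc N).trans (measure_mono ?_)
  · exact (MeasurableSet.biUnion (Set.to_countable _) fun n _ => hB n).nullMeasurableSet
  · exact fun N N' hNN' => Set.biUnion_subset_biUnion_left fun n hn => hNN'.trans hn
  · exact Set.subset_biUnion_of_mem (u := B) (show N ∈ {n | n ≥ N} by simp)

variable [Fintype S] {P : ProbAutomaton S AP}

lemma sum_toReal_pmf (μ : PMF S) : ∑ t, (μ t).toReal = 1 := by
  rw [← ENNReal.toReal_sum fun t _ => PMF.apply_ne_top _ _, ← tsum_fintype (L := .unconditional S),
    μ.tsum_coe, ENNReal.toReal_one]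

/-- The supremum of what certificates for `A` from `s` guarantee. -/
def certValue (P : ProbAutomaton S AP) (s : S) (A : Set (ℕ → S)) : ℝ :=
  sSup {c | ∃ g act, P.IsCertificate s A g act ∧ g [] = c}

lemma IsCertificate.le_certValue {s : S} {A : Set (ℕ → S)} {g : List S → ℝ}
    {act : List S → PMF S} (h : P.IsCertificate s A g act) : g [] ≤ P.certValue s A :=
  le_csSup ⟨1, by rintro _ ⟨g, act, h, rfl⟩; exact h.le_one _⟩ ⟨g, act, h, rfl⟩

lemma certValue_le_one (s : S) (A : Set (ℕ → S)) : P.certValue s A ≤ 1 :=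
  Real.sSup_le (by rintro _ ⟨g, act, h, rfl⟩; exact h.le_one _) zero_le_one

lemma certValue_nonneg (s : S) (A : Set (ℕ → S)) : 0 ≤ P.certValue s A :=
  Real.sSup_nonneg (by rintro _ ⟨g, act, h, rfl⟩; exact h.nonneg _)

lemma exists_isCertificate_gt (serial : ∀ s, ∃ μ : PMF S, (s, μ) ∈ P.step) (s : S)
    (A : Set (ℕ → S)) {ε : ℝ} (hε : 0 < ε) :
    ∃ g act, P.IsCertificate s A g act ∧ P.certValue s A - ε < g [] := by
  obtain ⟨act, hact⟩ := exists_isCertificate_zero serial s A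
  obtain ⟨_, ⟨g, act, h, rfl⟩, hlt⟩ := exists_lt_of_lt_csSup
    (s := {c | ∃ g act, P.IsCertificate s A g act ∧ g [] = c}) ⟨_, _, act, hact, rfl⟩
    (b := P.certValue s A - ε) (by change _ - ε < P.certValue s A; linarith)
  exact ⟨g, act, h, hlt⟩

lemma exists_pos_lt_of_finite {F : Set ℝ} (hF : F.Finite) :
    ∃ ε > 0, ∀ a ∈ F, 0 < a → ε < a := by
  have hF' : {a ∈ F | 0 < a}.Finite := hF.subset fun a h => h.1
  obtain ⟨b, hb, hb'⟩ : ∃ b > 0, ∀ a ∈ {a ∈ F | 0 < a}, b ≤ a := by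
    rcases {a ∈ F | 0 < a}.eq_empty_or_nonempty with h | h
    · exact ⟨1, one_pos, by simp [h]⟩
    · obtain ⟨b, hb, hmin⟩ := Set.exists_min_image _ id hF' h
      exact ⟨b, hb.2, hmin⟩
  exact ⟨b / 2, by linarith, fun a ha hpos => by linarith [hb' a ⟨ha, hpos⟩]⟩

/-- A certificate together with the state and the event that it is for; events are preimages of
subsets of `Q` under `Φ`. -/
structure CertState (P : ProbAutomaton S AP) {Q : Type*} (Φ : (ℕ → S) → Q) where
  state : S
  target : Set Q
  pot : List S → ℝ
  act : List S → PMF S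
  isCert : P.IsCertificate state (Φ ⁻¹' target) pot act

namespace CertState

variable {Q : Type*} {Φ : (ℕ → S) → Q}

/-- The certificate that remains after a move to the state `t`. -/
def shift {δ : S → Q → Q} (hΦ : ∀ ω, Φ ω = δ (ω 0) (Φ (tail ω))) (c : CertState P Φ) (t : S) :
    CertState P Φ where
  state := t
  target := δ c.state ⁻¹' c.target
  pot w := c.pot (t :: w)
  act w := c.act (t :: w)
  isCert := (c.isCert.shift t).mono fun ω hω => by
    change δ c.state (Φ ω) ∈ c.target
    have : Φ (consPath c.state ω) ∈ c.target := hω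
    rwa [hΦ, tail_consPath] at this

end CertState

variable [MeasurableSpace S] [DiscreteMeasurableSpace S] {Q : Type*} [Finite Q]

/-- An event that is recognised by a finite automaton reading sequences from the future to the
past has a scheduler that does at least as well as every certificate. -/
theorem exists_scheduler_certValue_le (serial : ∀ s, ∃ μ : PMF S, (s, μ) ∈ P.step)
    {Φ : (ℕ → S) → Q} {δ : S → Q → Q}
    (hΦ : ∀ ω, Φ ω = δ (ω 0) (Φ (tail ω))) (s : S) (T : Set Q) :
    ∃ σ : P.Scheduler, ENNReal.ofReal (P.certValue s (Φ ⁻¹' T)) ≤ σ.measure s (Φ ⁻¹' T) := by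
  classical
  let val (s : S) (T : Set Q) : ℝ := P.certValue s (Φ ⁻¹' T)
  -- a bound for positive values and for the losses of suboptimal transitions
  obtain ⟨ε, hε, hεval, hεstep⟩ : ∃ ε > 0, (∀ s T, 0 < val s T → ε < val s T) ∧
      ∀ s T μ, (s, μ) ∈ P.step → val s T - ε ≤ ∑ t, (μ t).toReal * val t (δ s ⁻¹' T) →
        val s T ≤ ∑ t, (μ t).toReal * val t (δ s ⁻¹' T) := by
    have hF : (Set.range (fun p : S × Set Q => val p.1 p.2) ∪
        ⋃ p : S × Set Q, (fun μ : PMF S => val p.1 p.2 - ∑ t, (μ t).toReal * val t (δ p.1 ⁻¹' p.2))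
          '' {μ | (p.1, μ) ∈ P.step}).Finite :=
      (Set.finite_range _).union (Set.finite_iUnion fun p => (P.imageFinite p.1).image _)
    obtain ⟨ε, hε, h⟩ := exists_pos_lt_of_finite hF
    refine ⟨ε, hε, fun s T => h _ (Or.inl ⟨(s, T), rfl⟩), fun s T μ hμ hle => ?_⟩
    by_contra! hlt
    have := h _ (Or.inr (Set.mem_iUnion.2 ⟨(s, T), μ, hμ, rfl⟩)) (sub_pos.2 hlt)
    simp only at this
    linarith
  have hbest (t : S) (T : Set Q) : ∃ c : CertState P Φ, c.state = t ∧ c.target = T ∧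
      val t T - ε / 2 < c.pot [] := by
    obtain ⟨g, act, h, hlt⟩ := exists_isCertificate_gt serial t (Φ ⁻¹' T) (half_pos hε)
    exact ⟨⟨t, T, g, act, h⟩, rfl, rfl, hlt⟩
  choose best hbs hbT hbv using hbest
  let M := {c : CertState P Φ // val c.state c.target - ε ≤ c.pot []} × ℕ
  have hbest_good (t : S) (T : Set Q) :
      val (best t T).state (best t T).target - ε ≤ (best t T).pot [] := by
    rw [hbs, hbT]; linarith [hbv t T]
  let upd (m : M) (t : S) : M :=
    if h : val t (δ m.1.1.state ⁻¹' m.1.1.target) - ε ≤ m.1.1.pot [t] then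
      (⟨m.1.1.shift hΦ t, h⟩, m.2)
    else (⟨best t (δ m.1.1.state ⁻¹' m.1.1.target), hbest_good _ _⟩, m.2 + 1)
  have hupd (m : M) (t : S) :
      (upd m t).1.1 = m.1.1.shift hΦ t ∧ (upd m t).2 = m.2 ∨
      (upd m t).1.1.state = t ∧ (upd m t).1.1.target = δ m.1.1.state ⁻¹' m.1.1.target ∧
        (upd m t).2 = m.2 + 1 ∧ m.1.1.pot [t] + ε / 2 ≤ (upd m t).1.1.pot [] := by
    simp only [upd]
    split_ifs with h
    · exact Or.inl ⟨rfl, rfl⟩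
    · refine Or.inr ⟨hbs _ _, hbT _ _, rfl, ?_⟩
      push Not at h
      have := hbv t (δ m.1.1.state ⁻¹' m.1.1.target)
      dsimp only
      linarith
  have hupd_state (m : M) (t : S) : (upd m t).1.1.state = t := by
    rcases hupd m t with h | h
    · rw [h.1]; rfl
    · exact h.1
  have hupd_target (m : M) (t : S) :
      (upd m t).1.1.target = δ m.1.1.state ⁻¹' m.1.1.target := by
    rcases hupd m t with h | h
    · rw [h.1]; rfl
    · exact h.2.1
  have hact (m : M) : (m.1.1.state, m.1.1.act []) ∈ P.step := m.1.1.isCert.step []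
  let m₀ : M := (⟨best s T, hbest_good _ _⟩, 0)
  have hs₀ : m₀.1.1.state = s := hbs _ _
  have hT₀ : m₀.1.1.target = T := hbT _ _
  obtain ⟨σ, hσ⟩ := exists_scheduler_of_controller serial upd (fun m => m.1.1.act [])
    (fun m => m.1.1.state) hact hupd_state m₀
  simp only [hs₀] at hσ
  refine ⟨σ, ?_⟩
  let run (ω : ℕ → S) (n : ℕ) : M := (word ω n).foldl upd m₀
  have hrun_succ (ω : ℕ → S) (n : ℕ) : run ω (n + 1) = upd (run ω n) (ω (n + 1)) := by
    simp only [run, word_succ, List.foldl_append, List.foldl_cons, List.foldl_nil]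
  -- the value of the memory is a submartingale
  have hval (n : ℕ) : val s T ≤
      ∫ ω, val (run ω n).1.1.state (run ω n).1.1.target ∂σ.measure s := by
    have := hσ (fun m => val m.1.1.state m.1.1.target) (fun m => by
      simp only [hupd_state, hupd_target]
      refine hεstep _ _ _ (hact m) ?_
      calc _ ≤ m.1.1.pot [] := m.1.2
        _ ≤ _ := m.1.1.isCert.le_sum []
        _ ≤ _ := Finset.sum_le_sum fun t _ => mul_le_mul_of_nonneg_left
          ((m.1.1.shift hΦ t).isCert.le_certValue) ENNReal.toReal_nonneg) n
    simpa only [hs₀, hT₀] using this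
  -- so is the current potential, reduced by a constant for each restart
  have hpot (n : ℕ) : ∫ ω, ((run ω n).2 : ℝ) ∂σ.measure s ≤ 2 / ε := by
    have := hσ (fun m => m.1.1.pot [] - ε / 2 * m.2) (fun m => by
      have h1 : ∑ t, (m.1.1.act [] t).toReal * (m.1.1.pot [t] - ε / 2 * m.2) ≤
          ∑ t, (m.1.1.act [] t).toReal * ((upd m t).1.1.pot [] - ε / 2 * (upd m t).2) := by
        refine Finset.sum_le_sum fun t _ => mul_le_mul_of_nonneg_left ?_ ENNReal.toReal_nonneg
        rcases hupd m t with h | h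
        · rw [h.1, h.2]; exact le_rfl
        · rw [h.2.2.1]; push_cast; linarith [h.2.2.2]
      refine le_trans ?_ h1
      have h2 := m.1.1.isCert.le_sum []
      simp only [List.nil_append] at h2
      simp only [mul_sub, Finset.sum_sub_distrib, ← Finset.sum_mul, sum_toReal_pmf, one_mul]
      linarith) n
    have h0 : 0 ≤ m₀.1.1.pot [] - ε / 2 * (m₀.2 : ℝ) := by
      have := m₀.1.1.isCert.nonneg []
      simpa [m₀] using this
    have h3 : ∫ ω, ((run ω n).1.1.pot [] - ε / 2 * ((run ω n).2 : ℝ)) ∂σ.measure s ≤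
        ∫ ω, (1 - ε / 2 * ((run ω n).2 : ℝ)) ∂σ.measure s :=
      integral_mono
        (integrable_word _ n fun w => (w.foldl upd m₀).1.1.pot [] - ε / 2 * (w.foldl upd m₀).2)
        (integrable_word _ n fun w => 1 - ε / 2 * (w.foldl upd m₀).2)
        fun ω => by simpa using (run ω n).1.1.isCert.le_one []
    rw [integral_sub (integrable_const _)
      (integrable_word _ n fun w => ε / 2 * (w.foldl upd m₀).2), integral_const_mul] at h3
    simp only [integral_const, probReal_univ, smul_eq_mul, mul_one] at h3
    have h4 := h0.trans (this.trans h3)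
    rw [le_div_iff₀ hε]
    linarith
  have hmono (ω : ℕ → S) : Monotone fun n => (run ω n).2 := monotone_nat_of_le_succ fun n => by
    rw [hrun_succ]
    rcases hupd (run ω n) (ω (n + 1)) with h | h
    · exact h.2.ge
    · rw [h.2.2.1]; exact Nat.le_succ _
  have hfin : ∀ᵐ ω ∂σ.measure s, ∃ N, ∀ n, (run ω n).2 ≤ (run ω N).2 := by
    have hmeas (n : ℕ) : Measurable fun ω => ((run ω n).2 : ENNReal) := by
      refine measurable_of_finite (fun h : Finset.Iic n → S =>
        ((((historyWord h).foldl upd m₀).2 : ℕ) : ENNReal)) |>.comp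
          (Preorder.measurable_frestrictLe (X := fun _ => S) n)
    have hlint : ∫⁻ ω, ⨆ n, ((run ω n).2 : ENNReal) ∂σ.measure s ≤ ENNReal.ofReal (2 / ε) := by
      rw [lintegral_iSup hmeas fun n n' h ω => by simpa using hmono ω h]
      refine iSup_le fun n => ?_
      have := ENNReal.ofReal_le_ofReal (hpot n)
      rw [ofReal_integral_eq_lintegral_ofReal
        (integrable_word _ n fun w => ((w.foldl upd m₀).2 : ℝ))
        (Eventually.of_forall fun ω => Nat.cast_nonneg _)] at this
      simpa only [ENNReal.ofReal_natCast] using this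
    filter_upwards [ae_lt_top (Measurable.iSup hmeas)
      (hlint.trans_lt ENNReal.ofReal_lt_top).ne] with ω hω
    obtain ⟨K, hK⟩ := ENNReal.exists_nat_gt hω.ne
    have hbdd : ∀ n, (run ω n).2 ≤ K := fun n => by
      have := (le_iSup (fun n => ((run ω n).2 : ENNReal)) n).trans hK.le
      exact_mod_cast this
    obtain ⟨_, ⟨N, rfl⟩, hN⟩ := Set.exists_max_image (Set.range fun n => (run ω n).2) id
      ((Set.finite_Iic K).subset (by rintro _ ⟨n, rfl⟩; exact hbdd n)) ⟨_, 0, rfl⟩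
    exact ⟨N, fun n => hN _ ⟨n, rfl⟩⟩
  -- with finitely many restarts, infinitely often positive value implies success
  have hwin : ∀ ω : ℕ → S, ω 0 = s → (∃ N, ∀ n, (run ω n).2 ≤ (run ω N).2) →
      (∃ᶠ n in atTop, 0 < val (run ω n).1.1.state (run ω n).1.1.target) → ω ∈ Φ ⁻¹' T := by
    rintro ω h0 ⟨N, hN⟩ hfreq
    have hstate (n : ℕ) : (run ω n).1.1.state = ω n := by
      cases n with
      | zero => exact hs₀.trans h0.symm
      | succ n => rw [hrun_succ]; exact hupd_state _ _
    have htarget (n : ℕ) : Φ (fun j => ω (n + j)) ∈ (run ω n).1.1.target ↔ Φ ω ∈ T := by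
      induction n with
      | zero => simp only [zero_add]; exact iff_of_eq (congrArg (Φ ω ∈ ·) hT₀)
      | succ n ih =>
        rw [← ih, hrun_succ, hupd_target, hΦ fun j => ω (n + j), hstate]
        have : tail (fun j => ω (n + j)) = fun j => ω (n + 1 + j) := by
          funext j; simp only [tail, add_assoc]
        rw [this]
        rfl
    have hkeep (n : ℕ) (hn : N ≤ n) :
        (run ω (n + 1)).1.1 = (run ω n).1.1.shift hΦ (ω (n + 1)) := by
      rw [hrun_succ]
      rcases hupd (run ω n) (ω (n + 1)) with h | h
      · exact h.1
      · exfalso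
        have h1 := hN (n + 1)
        rw [hrun_succ, h.2.2.1] at h1
        have h2 : (run ω N).2 ≤ (run ω n).2 := hmono ω hn
        omega
    have hpotN (j : ℕ) (w : List S) : (run ω (N + j)).1.1.pot w =
        (run ω N).1.1.pot (word (fun j => ω (N + j)) j ++ w) := by
      induction j generalizing w with
      | zero => rfl
      | succ j ih =>
        rw [← add_assoc, hkeep _ (Nat.le_add_right _ _), word_succ, List.append_assoc]
        exact ih _
    rw [Set.mem_preimage, ← htarget N]
    refine (run ω N).1.1.isCert.mem _ (hstate N).symm ?_
    rw [frequently_atTop] at hfreq ⊢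
    intro K
    obtain ⟨n, hn, hpos⟩ := hfreq (N + K)
    obtain ⟨j, rfl⟩ := Nat.exists_eq_add_of_le (le_of_add_le_left hn)
    refine ⟨j, by omega, ?_⟩
    have h1 := hpotN j []
    rw [List.append_nil] at h1
    rw [← h1]
    have h2 := (run ω (N + j)).1.2
    have h3 := hεval _ _ hpos
    linarith
  have hBm (n : ℕ) : MeasurableSet
      {ω | 0 < val (run ω n).1.1.state (run ω n).1.1.target} :=
    measurableSet_word n {w | 0 < val (w.foldl upd m₀).1.1.state (w.foldl upd m₀).1.1.target}
  refine (le_measure_frequently (c := ENNReal.ofReal (val s T)) hBm fun n => ?_).trans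
    (measure_mono_ae ?_)
  · refine ENNReal.ofReal_le_of_le_toReal ((hval n).trans ?_)
    rw [← measureReal_def, ← integral_indicator_one (hBm n)]
    refine integral_mono
      (integrable_word _ n fun w => val (w.foldl upd m₀).1.1.state (w.foldl upd m₀).1.1.target)
      ((integrable_const _).indicator (hBm n)) fun ω => ?_
    by_cases h : 0 < val (run ω n).1.1.state (run ω n).1.1.target
    · rw [Set.indicator_of_mem (by exact h)]
      exact certValue_le_one _ _
    · rw [Set.indicator_of_notMem (by exact h)]
      exact not_lt.1 h
  · filter_upwards [hfin, σ.ae_zero_eq s] with ω h1 h2 h3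
    exact hwin ω h2 h1 h3

end Attainment

/-- The event `A` is invariant under replacing the first `n + 1` states by `R`-related ones. -/
def InvariantUpTo (R : S → S → Prop) (n : ℕ) (A : Set (ℕ → S)) : Prop :=
  ∀ ω ω', (∀ k ≤ n, R (ω k) (ω' k)) → (ω ∈ A ↔ ω' ∈ A)

/-- The event `A` is invariant under replacing all states by `R`-related ones. -/
def InvariantUnder (R : S → S → Prop) (A : Set (ℕ → S)) : Prop :=
  ∀ ω ω', (∀ k, R (ω k) (ω' k)) → (ω ∈ A ↔ ω' ∈ A)

lemma InvariantUpTo.compl {R : S → S → Prop} {n : ℕ} {A : Set (ℕ → S)}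
    (h : InvariantUpTo R n A) : InvariantUpTo R n Aᶜ :=
  fun ω ω' hω => not_congr (h ω ω' hω)

lemma InvariantUpTo.mono {R R' : S → S → Prop} {n m : ℕ} {A : Set (ℕ → S)}
    (h : InvariantUpTo R n A) (hR : ∀ s r, R' s r → R s r) (hnm : n ≤ m) :
    InvariantUpTo R' m A :=
  fun ω ω' hω => h ω ω' fun k hk => hR _ _ (hω k (hk.trans hnm))

lemma InvariantUnder.compl {R : S → S → Prop} {A : Set (ℕ → S)}
    (h : InvariantUnder R A) : InvariantUnder R Aᶜ :=
  fun ω ω' hω => not_congr (h ω ω' hω)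

section Recognizable

variable [MeasurableSpace S]

/-- The event `A` is recognised by a finite automaton that reads sequences from the future to the
past. -/
def Recognizable (A : Set (ℕ → S)) : Prop :=
  ∃ (Q : Type u) (_ : Finite Q) (Φ : (ℕ → S) → Q) (δ : S → Q → Q) (T : Set Q),
    (∀ B : Set Q, MeasurableSet (Φ ⁻¹' B)) ∧ (∀ ω, Φ ω = δ (ω 0) (Φ (tail ω))) ∧ A = Φ ⁻¹' T

lemma Recognizable.measurableSet {A : Set (ℕ → S)} (h : Recognizable A) : MeasurableSet A := by
  obtain ⟨Q, _, Φ, δ, T, hm, -, rfl⟩ := h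
  exact hm T

lemma Recognizable.compl {A : Set (ℕ → S)} (h : Recognizable A) : Recognizable Aᶜ := by
  obtain ⟨Q, hQ, Φ, δ, T, hm, hδ, rfl⟩ := h
  exact ⟨Q, hQ, Φ, δ, Tᶜ, hm, hδ, rfl⟩

lemma measurableSet_preimage_prodMk {X Q Q' : Type*} [MeasurableSpace X] [Finite Q] [Finite Q']
    {Φ : X → Q} {Φ' : X → Q'} (h : ∀ B : Set Q, MeasurableSet (Φ ⁻¹' B))
    (h' : ∀ B : Set Q', MeasurableSet (Φ' ⁻¹' B)) (B : Set (Q × Q')) :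
    MeasurableSet ((fun x => (Φ x, Φ' x)) ⁻¹' B) := by
  let _ : MeasurableSpace Q := ⊤
  let _ : MeasurableSpace Q' := ⊤
  have : DiscreteMeasurableSpace Q := ⟨fun _ => trivial⟩
  have : DiscreteMeasurableSpace Q' := ⟨fun _ => trivial⟩
  have hΦ : Measurable Φ := fun B _ => h B
  have hΦ' : Measurable Φ' := fun B _ => h' B
  exact hΦ.prodMk hΦ' (Set.toFinite B).measurableSet

lemma measurableSet_preimage_ulift_mem {X : Type*} [MeasurableSpace X] {A : Set X}
    (hA : MeasurableSet A) (B : Set (ULift.{u} Prop)) :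
    MeasurableSet ((fun x => ULift.up (x ∈ A)) ⁻¹' B) := by
  classical
  have : (fun x => ULift.up.{u} (x ∈ A)) ⁻¹' B =
      (A ∩ {_x | ULift.up True ∈ B}) ∪ (Aᶜ ∩ {_x | ULift.up False ∈ B}) := by
    ext x
    by_cases hx : x ∈ A <;> simp [hx]
  rw [this]
  exact (hA.inter (.const _)).union (hA.compl.inter (.const _))

lemma Recognizable.inter {A B : Set (ℕ → S)} (hA : Recognizable A) (hB : Recognizable B) :
    Recognizable (A ∩ B) := by
  obtain ⟨Q, _, Φ, δ, T, hm, hδ, rfl⟩ := hA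
  obtain ⟨Q', _, Φ', δ', T', hm', hδ', rfl⟩ := hB
  exact ⟨Q × Q', inferInstance, fun ω => (Φ ω, Φ' ω), fun s q => (δ s q.1, δ' s q.2), T ×ˢ T',
    measurableSet_preimage_prodMk hm hm', fun ω => Prod.ext (hδ ω) (hδ' ω), rfl⟩

lemma measurable_tail : Measurable (tail : (ℕ → S) → ℕ → S) :=
  measurable_pi_lambda _ fun n => measurable_pi_apply (1 + n)

lemma Recognizable.next {A : Set (ℕ → S)} (hA : Recognizable A) :
    Recognizable {ω | tail ω ∈ A} := by
  have hAm := hA.measurableSet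
  obtain ⟨Q, _, Φ, δ, T, hm, hδ, rfl⟩ := hA
  refine ⟨Q × ULift Prop, inferInstance, fun ω => (Φ ω, ⟨ω ∈ tail ⁻¹' (Φ ⁻¹' T)⟩),
    fun s q => (δ s q.1, ⟨q.1 ∈ T⟩), {q | q.2.down}, measurableSet_preimage_prodMk hm
      (measurableSet_preimage_ulift_mem (hAm.preimage measurable_tail)),
    fun ω => Prod.ext (hδ ω) rfl, rfl⟩

lemma Recognizable.until {A B : Set (ℕ → S)} (hA : Recognizable A) (hB : Recognizable B) :
    Recognizable {ω | ∃ j, (fun n => ω (j + n)) ∈ B ∧ ∀ k < j, (fun n => ω (k + n)) ∈ A} := by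
  have hAm := hA.measurableSet
  have hBm := hB.measurableSet
  obtain ⟨Q, _, Φ, δ, T, hm, hδ, rfl⟩ := hA
  obtain ⟨Q', _, Φ', δ', T', hm', hδ', rfl⟩ := hB
  set U : Set (ℕ → S) := {ω | ∃ j, (fun n => ω (j + n)) ∈ Φ' ⁻¹' T' ∧
    ∀ k < j, (fun n => ω (k + n)) ∈ Φ ⁻¹' T} with hU
  have hsuffix (k : ℕ) : Measurable fun (ω : ℕ → S) n => ω (k + n) :=
    measurable_pi_lambda _ fun n => measurable_pi_apply (k + n)
  have hUm : MeasurableSet U := by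
    have : U = ⋃ j, ((fun ω n => ω (j + n)) ⁻¹' (Φ' ⁻¹' T') ∩
        ⋂ k ∈ Set.Iio j, (fun ω n => ω (k + n)) ⁻¹' (Φ ⁻¹' T)) := by
      ext ω
      simp only [hU, Set.mem_iUnion, Set.mem_inter_iff, Set.mem_iInter, Set.mem_Iio]
      rfl
    rw [this]
    exact .iUnion fun j => (hBm.preimage (hsuffix j)).inter
      (.biInter (Set.to_countable _) fun k _ => hAm.preimage (hsuffix k))
  have hunfold (ω : ℕ → S) : ω ∈ U ↔ Φ' ω ∈ T' ∨ Φ ω ∈ T ∧ tail ω ∈ U := by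
    have hz : (fun n => ω (0 + n)) = ω := by funext n; rw [zero_add]
    have ht (j : ℕ) : (fun n => tail ω (j + n)) = fun n => ω (j + 1 + n) := by
      funext n; simp only [tail]; congr 1; omega
    constructor
    · rintro ⟨j, h1, h2⟩
      cases j with
      | zero => exact Or.inl (by rwa [hz] at h1)
      | succ j =>
        refine Or.inr ⟨by have := h2 0 j.succ_pos; rwa [hz] at this, j, ?_, fun k hk => ?_⟩
        · rw [ht]; exact h1
        · rw [ht]; exact h2 (k + 1) (by omega)
    · rintro (h | ⟨h, j, h1, h2⟩)
      · exact ⟨0, by rwa [hz], by simp⟩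
      · refine ⟨j + 1, by rwa [ht] at h1, fun k hk => ?_⟩
        cases k with
        | zero => rwa [hz]
        | succ k => have := h2 k (by omega); rwa [ht] at this
  refine ⟨(Q × Q') × ULift Prop, inferInstance, fun ω => ((Φ ω, Φ' ω), ⟨ω ∈ U⟩),
    fun s q => ((δ s q.1.1, δ' s q.1.2), ⟨δ' s q.1.2 ∈ T' ∨ δ s q.1.1 ∈ T ∧ q.2.down⟩),
    {q | q.2.down}, measurableSet_preimage_prodMk (measurableSet_preimage_prodMk hm hm')
      (measurableSet_preimage_ulift_mem hUm),
    fun ω => Prod.ext (Prod.ext (hδ ω) (hδ' ω)) (ULift.ext _ _ (propext ?_)), rfl⟩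
  simp only [← hδ, ← hδ']
  exact hunfold ω

variable [DiscreteMeasurableSpace S]

lemma recognizable_zero_mem (C : Set S) : Recognizable {ω : ℕ → S | ω 0 ∈ C} :=
  ⟨ULift Prop, inferInstance, fun ω => ⟨ω ∈ {ω : ℕ → S | ω 0 ∈ C}⟩, fun s _ => ⟨s ∈ C⟩,
    {q | q.down}, measurableSet_preimage_ulift_mem
      (MeasurableSet.of_discrete.preimage (measurable_pi_apply 0)), fun _ => rfl, rfl⟩

lemma InvariantUpTo.recognizable [Finite S] {n : ℕ} {A : Set (ℕ → S)}
    (h : InvariantUpTo (· = ·) n A) : Recognizable A := by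
  let Φ (ω : ℕ → S) : Fin (n + 1) → S := fun k => ω k
  have hΦ : Measurable Φ := measurable_pi_lambda _ fun k => measurable_pi_apply _
  refine ⟨Fin (n + 1) → S, inferInstance, Φ, fun s q => Fin.cons s fun k : Fin n => q k.castSucc,
    Φ '' A, fun B => (Set.toFinite B).measurableSet.preimage hΦ, fun ω => ?_, ?_⟩
  · funext k
    refine Fin.cases rfl (fun k => ?_) k
    simp [Φ, tail, add_comm]
  · refine (Set.subset_preimage_image _ _).antisymm ?_
    rintro ω ⟨ω', hω', heq⟩
    exact (h ω' ω fun k hk => congrFun heq ⟨k, Nat.lt_succ_of_le hk⟩).1 hω'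

variable [Finite S]

lemma recognizable_pathSat (P : ProbAutomaton S AP) (ψ : PathFormula AP) :
    Recognizable {ω | P.PathSat ψ ω} := by
  match ψ with
  | .state φ =>
    simp only [PathSat]
    exact recognizable_zero_mem {s | P.Sat φ s}
  | .and ψ₁ ψ₂ =>
    simp only [PathSat]
    exact (recognizable_pathSat P ψ₁).inter (recognizable_pathSat P ψ₂)
  | .not ψ =>
    simp only [PathSat]
    exact (recognizable_pathSat P ψ).compl
  | .next ψ =>
    simp only [PathSat]
    exact (recognizable_pathSat P ψ).next
  | .until ψ₁ ψ₂ =>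
    simp only [PathSat]
    exact (recognizable_pathSat P ψ₁).until (recognizable_pathSat P ψ₂)

end Recognizable

section MaxProb

variable [Fintype S] [MeasurableSpace S] [DiscreteMeasurableSpace S] {P : ProbAutomaton S AP}

/-- The supremum over the schedulers of the probability of an event. -/
def maxProb (P : ProbAutomaton S AP) (s : S) (A : Set (ℕ → S)) : ENNReal :=
  ⨆ σ : P.Scheduler, σ.measure s A

lemma measure_le_maxProb (σ : P.Scheduler) (s : S) (A : Set (ℕ → S)) :
    σ.measure s A ≤ P.maxProb s A :=
  le_iSup (fun σ : P.Scheduler => σ.measure s A) σ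

lemma maxProb_le_one (s : S) (A : Set (ℕ → S)) : P.maxProb s A ≤ 1 :=
  iSup_le fun _ => prob_le_one

lemma maxProb_ne_top (s : S) (A : Set (ℕ → S)) : P.maxProb s A ≠ ⊤ :=
  ((maxProb_le_one s A).trans_lt ENNReal.one_lt_top).ne

variable (serial : ∀ s, ∃ μ : PMF S, (s, μ) ∈ P.step)
include serial

lemma maxProb_le_certValue (s : S) {A : Set (ℕ → S)} (hA : MeasurableSet A) :
    P.maxProb s A ≤ ENNReal.ofReal (P.certValue s A) := by
  refine iSup_le fun σ => le_of_not_gt fun hlt => ?_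
  obtain ⟨g, act, h, hg, -⟩ := exists_isCertificate_of_lt serial σ s hA (certValue_nonneg s A) hlt
  exact hg.not_ge h.le_certValue

lemma Recognizable.exists_scheduler {A : Set (ℕ → S)} (hA : Recognizable A) (s : S) :
    ∃ σ : P.Scheduler, ENNReal.ofReal (P.certValue s A) ≤ σ.measure s A := by
  obtain ⟨Q, _, Φ, δ, T, hm, hδ, rfl⟩ := hA
  exact exists_scheduler_certValue_le serial hδ s T

lemma Recognizable.exists_measure_eq_maxProb {A : Set (ℕ → S)} (hA : Recognizable A) (s : S) :
    ∃ σ : P.Scheduler, σ.measure s A = P.maxProb s A := by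
  obtain ⟨σ, hσ⟩ := hA.exists_scheduler serial s
  exact ⟨σ, (measure_le_maxProb σ s A).antisymm
    ((maxProb_le_certValue serial s hA.measurableSet).trans hσ)⟩

lemma Recognizable.exists_measureReal_eq {A : Set (ℕ → S)} (hA : Recognizable A) (s : S) :
    ∃ σ : P.Scheduler, (σ.measure s).real A = (P.maxProb s A).toReal := by
  obtain ⟨σ, hσ⟩ := hA.exists_measure_eq_maxProb serial s
  exact ⟨σ, by rw [measureReal_def, hσ]⟩

omit serial in
lemma measureReal_le_maxProb (σ : P.Scheduler) (s : S) (A : Set (ℕ → S)) :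
    (σ.measure s).real A ≤ (P.maxProb s A).toReal :=
  ENNReal.toReal_mono (maxProb_ne_top s A) (measure_le_maxProb σ s A)

omit serial in
lemma measureReal_paths_inter (σ : P.Scheduler) (s : S) (A : Set (ℕ → S)) :
    (σ.measure s).real {ω | ω ∈ P.paths s ∧ ω ∈ A} = (σ.measure s).real A := by
  rw [measureReal_def, σ.measure_paths_inter, measureReal_def]

/-- The satisfaction of a probabilistic state formula in terms of maximal probabilities. -/
lemma sat_prob_iff (c : Comparison) (q : Set.Icc (0 : ℝ) 1) (ψ : PathFormula AP) (s : S) :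
    P.Sat (.prob c q ψ) s ↔ match c with
      | .lt => (P.maxProb s {ω | P.PathSat ψ ω}).toReal < q
      | .le => (P.maxProb s {ω | P.PathSat ψ ω}).toReal ≤ q
      | .gt => 1 - (P.maxProb s {ω | P.PathSat ψ ω}ᶜ).toReal > q
      | .ge => 1 - (P.maxProb s {ω | P.PathSat ψ ω}ᶜ).toReal ≥ q := by
  set A := {ω | P.PathSat ψ ω} with hAdef
  have hA : Recognizable A := recognizable_pathSat P ψ
  have hsat : P.Sat (.prob c q ψ) s ↔ ∀ σ : P.Scheduler, c.holds ((σ.measure s).real A) q := by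
    simp only [Sat]
    refine forall_congr' fun σ => ?_
    rw [← measureReal_paths_inter σ s A]
    rfl
  have hcompl (σ : P.Scheduler) : (σ.measure s).real A = 1 - (σ.measure s).real Aᶜ := by
    rw [probReal_compl_eq_one_sub hA.measurableSet]; ring
  obtain ⟨σ₁, h₁⟩ := hA.exists_measureReal_eq serial s
  obtain ⟨σ₂, h₂⟩ := hA.compl.exists_measureReal_eq serial s
  have hle₁ (σ : P.Scheduler) := measureReal_le_maxProb σ s A
  have hle₂ (σ : P.Scheduler) := measureReal_le_maxProb σ s Aᶜ
  rw [hsat]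
  cases c <;> simp only [Comparison.holds]
  · exact ⟨fun h => h₁ ▸ h σ₁, fun h σ => (hle₁ σ).trans_lt h⟩
  · exact ⟨fun h => by rw [← h₂, ← hcompl]; exact h σ₂,
      fun h σ => by rw [hcompl]; linarith [hle₂ σ]⟩
  · exact ⟨fun h => h₁ ▸ h σ₁, fun h σ => (hle₁ σ).trans h⟩
  · exact ⟨fun h => by rw [← h₂, ← hcompl]; exact h σ₂,
      fun h σ => by rw [hcompl]; linarith [hle₂ σ]⟩

lemma sat_prob_congr (c : Comparison) (q : Set.Icc (0 : ℝ) 1) (ψ : PathFormula AP) {s r : S}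
    (h : P.maxProb s {ω | P.PathSat ψ ω} = P.maxProb r {ω | P.PathSat ψ ω})
    (h' : P.maxProb s {ω | P.PathSat ψ ω}ᶜ = P.maxProb r {ω | P.PathSat ψ ω}ᶜ) :
    P.Sat (.prob c q ψ) s ↔ P.Sat (.prob c q ψ) r := by
  rw [sat_prob_iff serial, sat_prob_iff serial, h, h']

lemma maxProb_eq_of_sat {ψ : PathFormula AP} {s r : S}
    (h : ∀ q, P.Sat (.prob .le q ψ) s ↔ P.Sat (.prob .le q ψ) r) :
    P.maxProb s {ω | P.PathSat ψ ω} = P.maxProb r {ω | P.PathSat ψ ω} := by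
  simp only [sat_prob_iff serial] at h
  have hI (s : S) : (P.maxProb s {ω | P.PathSat ψ ω}).toReal ∈ Set.Icc (0 : ℝ) 1 :=
    ⟨ENNReal.toReal_nonneg, ENNReal.toReal_le_of_le_ofReal zero_le_one
      (by simpa using maxProb_le_one s _)⟩
  refine (ENNReal.toReal_eq_toReal_iff' (maxProb_ne_top _ _) (maxProb_ne_top _ _)).1
    (le_antisymm ?_ ?_)
  · exact (h ⟨_, hI r⟩).2 le_rfl
  · exact (h ⟨_, hI s⟩).1 le_rfl

mutual

/-- State formulae of depth `i` do not distinguish states with the same labels and the same maximal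
probabilities of events of depth `i`. -/
theorem sat_congr_of_inFragment {i : ℕ} {R : S → S → Prop}
    (hlabel : ∀ s r, R s r → P.label s = P.label r)
    (hmax : ∀ A, InvariantUpTo R i A → ∀ s r, R s r → P.maxProb s A = P.maxProb r A)
    (φ : StateFormula AP) (hφ : φ.InFragment i) (s r : S) (hsr : R s r) :
    P.Sat φ s ↔ P.Sat φ r := by
  match φ with
  | .atom a => simp only [Sat, hlabel s r hsr]
  | .and φ₁ φ₂ =>
    simp only [StateFormula.InFragment] at hφ
    simp only [Sat]
    exact and_congr (sat_congr_of_inFragment hlabel hmax φ₁ hφ.1 s r hsr)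
      (sat_congr_of_inFragment hlabel hmax φ₂ hφ.2 s r hsr)
  | .not φ =>
    simp only [StateFormula.InFragment] at hφ
    simp only [Sat]
    exact not_congr (sat_congr_of_inFragment hlabel hmax φ hφ s r hsr)
  | .prob c q ψ =>
    simp only [StateFormula.InFragment] at hφ
    have h : InvariantUpTo R i {ω | P.PathSat ψ ω} := fun ω ω' hω =>
      pathSat_congr_of_inFragment hlabel hmax ψ hφ.2 ω ω' fun k hk => hω k (hk.trans hφ.1)
    exact sat_prob_congr serial c q ψ (hmax _ h s r hsr) (hmax _ h.compl s r hsr)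

theorem pathSat_congr_of_inFragment {i : ℕ} {R : S → S → Prop}
    (hlabel : ∀ s r, R s r → P.label s = P.label r)
    (hmax : ∀ A, InvariantUpTo R i A → ∀ s r, R s r → P.maxProb s A = P.maxProb r A)
    (ψ : PathFormula AP) (hψ : ψ.InFragment i) (ω ω' : ℕ → S)
    (hω : ∀ k ≤ ψ.depth, R (ω k) (ω' k)) : P.PathSat ψ ω ↔ P.PathSat ψ ω' := by
  match ψ with
  | .state φ =>
    simp only [PathFormula.InFragment] at hψ
    simp only [PathSat]
    exact sat_congr_of_inFragment hlabel hmax φ hψ _ _ (hω 0 (Nat.zero_le _))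
  | .and ψ₁ ψ₂ =>
    simp only [PathFormula.InFragment] at hψ
    simp only [PathFormula.depth] at hω
    simp only [PathSat]
    exact and_congr
      (pathSat_congr_of_inFragment hlabel hmax ψ₁ hψ.1 ω ω' fun k hk => hω k (by omega))
      (pathSat_congr_of_inFragment hlabel hmax ψ₂ hψ.2 ω ω' fun k hk => hω k (by omega))
  | .not ψ =>
    simp only [PathFormula.InFragment] at hψ
    simp only [PathFormula.depth] at hω
    simp only [PathSat]
    exact not_congr (pathSat_congr_of_inFragment hlabel hmax ψ hψ ω ω' hω)
  | .next ψ =>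
    simp only [PathFormula.InFragment] at hψ
    simp only [PathFormula.depth] at hω
    simp only [PathSat]
    exact pathSat_congr_of_inFragment hlabel hmax ψ hψ _ _ fun k hk => hω (1 + k) (by omega)
  | .until ψ₁ ψ₂ => simp only [PathFormula.InFragment] at hψ

end

mutual

/-- State formulae do not distinguish states with the same labels and the same maximal
probabilities of recognisable events. -/
theorem sat_congr {R : S → S → Prop}
    (hlabel : ∀ s r, R s r → P.label s = P.label r)
    (hmax : ∀ A, Recognizable A → InvariantUnder R A →
      ∀ s r, R s r → P.maxProb s A = P.maxProb r A)
    (φ : StateFormula AP) (s r : S) (hsr : R s r) : P.Sat φ s ↔ P.Sat φ r := by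
  match φ with
  | .atom a => simp only [Sat, hlabel s r hsr]
  | .and φ₁ φ₂ =>
    simp only [Sat]
    exact and_congr (sat_congr hlabel hmax φ₁ s r hsr) (sat_congr hlabel hmax φ₂ s r hsr)
  | .not φ =>
    simp only [Sat]
    exact not_congr (sat_congr hlabel hmax φ s r hsr)
  | .prob c q ψ =>
    have h : InvariantUnder R {ω | P.PathSat ψ ω} := pathSat_congr hlabel hmax ψ
    have hr := recognizable_pathSat P ψ
    exact sat_prob_congr serial c q ψ (hmax _ hr h s r hsr) (hmax _ hr.compl h.compl s r hsr)

theorem pathSat_congr {R : S → S → Prop}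
    (hlabel : ∀ s r, R s r → P.label s = P.label r)
    (hmax : ∀ A, Recognizable A → InvariantUnder R A →
      ∀ s r, R s r → P.maxProb s A = P.maxProb r A)
    (ψ : PathFormula AP) (ω ω' : ℕ → S) (hω : ∀ k, R (ω k) (ω' k)) :
    P.PathSat ψ ω ↔ P.PathSat ψ ω' := by
  match ψ with
  | .state φ =>
    simp only [PathSat]
    exact sat_congr hlabel hmax φ _ _ (hω 0)
  | .and ψ₁ ψ₂ =>
    simp only [PathSat]
    exact and_congr (pathSat_congr hlabel hmax ψ₁ ω ω' hω) (pathSat_congr hlabel hmax ψ₂ ω ω' hω)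
  | .not ψ =>
    simp only [PathSat]
    exact not_congr (pathSat_congr hlabel hmax ψ ω ω' hω)
  | .next ψ =>
    simp only [PathSat]
    exact pathSat_congr hlabel hmax ψ _ _ fun k => hω (1 + k)
  | .until ψ₁ ψ₂ =>
    simp only [PathSat]
    exact exists_congr fun j => and_congr
      (pathSat_congr hlabel hmax ψ₂ _ _ fun k => hω (j + k))
      (forall₂_congr fun l _ => pathSat_congr hlabel hmax ψ₁ _ _ fun k => hω (l + k))

end

end MaxProb

section OneStep

variable {P : ProbAutomaton S AP}

variable [Fintype S] [MeasurableSpace S] [DiscreteMeasurableSpace S]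

lemma Scheduler.measure_one_mem (σ : P.Scheduler) (s : S) (C : Set S) :
    σ.measure s {ω | ω 1 ∈ C} = (σ.next 0 fun _ => s).toOuterMeasure C := by
  have h := congrArg (fun k : Kernel (Finset.Iic 0 → S) S => k (fun _ => s) C)
    (Kernel.map_traj_succ_self (X := fun _ => S) (κ := σ.kernel) (a := 0))
  rw [Kernel.map_apply' _ (measurable_pi_apply _) _ (MeasurableSet.of_discrete)] at h
  exact h.trans (PMF.toMeasure_apply_eq_toOuterMeasure _ _)

lemma Scheduler.exists_step_measure_one_le (σ : P.Scheduler) (s : S) (C : Set S) :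
    ∃ μ : PMF S, (s, μ) ∈ P.step ∧ σ.measure s {ω | ω 1 ∈ C} ≤ μ.toOuterMeasure C := by
  classical
  obtain ⟨μ, hμ, hle⟩ := σ.exists_step_tsum_le 0 (fun _ => s) (C.indicator 1)
  refine ⟨μ, hμ, ?_⟩
  rw [σ.measure_one_mem, PMF.toOuterMeasure_apply, PMF.toOuterMeasure_apply, tsum_fintype,
    tsum_fintype]
  simpa [Set.indicator_apply] using hle

lemma exists_scheduler_measure_one_eq (serial : ∀ s, ∃ μ : PMF S, (s, μ) ∈ P.step) {s : S}
    {μ : PMF S} (hμ : (s, μ) ∈ P.step) (C : Set S) :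
    ∃ σ : P.Scheduler, σ.measure s {ω | ω 1 ∈ C} = μ.toOuterMeasure C := by
  classical
  choose d hd using serial
  refine ⟨Scheduler.ofAct (fun n h => if (h ⟨n, Finset.mem_Iic.2 le_rfl⟩, μ) ∈ P.step then μ else
    d (h ⟨n, Finset.mem_Iic.2 le_rfl⟩)) fun n h => ?_, ?_⟩
  · split_ifs with hh
    · exact hh
    · exact hd _
  · rw [Scheduler.measure_one_mem, Scheduler.next_ofAct, if_pos hμ]

end OneStep

lemma downClosed_of_saturated {R E : S → S → Prop} (hR : ∀ s, R s s)
    (hRE : ∀ s r, R s r → E s r) {C : Set S} (hC : ∀ s r, E s r → (s ∈ C ↔ r ∈ C)) :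
    DownClosed R C := by
  ext s
  exact ⟨fun hs => ⟨s, hs, hR s⟩, fun ⟨r, hr, hsr⟩ => (hC s r (hRE s r hsr)).2 hr⟩

section Soundness

variable {P : ProbAutomaton S AP}

/-- The set-paths of length `i` that consist of the classes of the sequences in `A`. -/
def classPaths (E : S → S → Prop) (i : ℕ) (A : Set (ℕ → S)) : Set (SetPath S) :=
  {Ω | ∃ ω ∈ A, Ω = ⟨i, fun k => {t | E (ω k) t}⟩}

lemma coneFrom_classPaths {E : S → S → Prop} (hE : ∀ s, E s s) {i : ℕ} {A : Set (ℕ → S)}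
    (hA : InvariantUpTo E i A) (s : S) :
    P.coneFrom s (classPaths E i A) = {ω | ω ∈ P.paths s ∧ ω ∈ A} := by
  ext ω
  refine and_congr_right fun _ => ⟨?_, fun h => ⟨_, ⟨ω, h, rfl⟩, fun k => hE _⟩⟩
  rintro ⟨_, ⟨ω', h, rfl⟩, hk⟩
  exact (hA ω' ω fun k hk' => hk ⟨k, Nat.lt_succ_of_le hk'⟩).1 h

lemma isGreatest_classPaths (E : S → S → Prop) (i : ℕ) {A : Set (ℕ → S)} (hA : A.Nonempty) :
    IsGreatest (Sigma.fst '' classPaths E i A) i := by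
  obtain ⟨ω, hω⟩ := hA
  refine ⟨⟨_, ⟨ω, hω, rfl⟩, rfl⟩, ?_⟩
  rintro _ ⟨_, ⟨ω', -, rfl⟩, rfl⟩
  exact le_rfl

lemma classPaths_subset {R E : S → S → Prop} (hR : ∀ s, R s s)
    (hRE : ∀ s r, R s r → E s r) (hE : Equivalence E) {i : ℕ} (hi : 1 ≤ i) (A : Set (ℕ → S)) :
    classPaths E i A ⊆ closedSetPaths R := by
  rintro _ ⟨ω, -, rfl⟩
  exact ⟨hi, fun k => downClosed_of_saturated hR hRE fun s r hsr =>
    ⟨fun h => hE.trans h hsr, fun h => hE.trans h (hE.symm hsr)⟩⟩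

variable [Fintype S] [MeasurableSpace S] [DiscreteMeasurableSpace S]

lemma maxProb_le_of_dominates {s r : S} {A : Set (ℕ → S)}
    (h : ∀ σ : P.Scheduler, 0 < (σ.measure s).real A →
      ∃ σ' : P.Scheduler, (σ'.measure r).real A ≥ (σ.measure s).real A) :
    P.maxProb s A ≤ P.maxProb r A := by
  refine iSup_le fun σ => ?_
  rcases (measureReal_nonneg (μ := σ.measure s) (s := A)).eq_or_lt with h0 | h0
  · rw [(measureReal_eq_zero_iff).1 h0.symm]
    exact zero_le
  · obtain ⟨σ', hσ'⟩ := h σ h0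
    exact ((ENNReal.toReal_le_toReal (measure_ne_top _ _) (measure_ne_top _ _)).1 hσ').trans
      (measure_le_maxProb σ' r A)

lemma maxProb_le_of_forall_cone {E : S → S → Prop} (hE : ∀ s, E s s) {i : ℕ} {A : Set (ℕ → S)}
    (hA : InvariantUpTo E i A) {s r : S}
    (h : ∀ σ : P.Scheduler, 0 < (σ.measure s).real (P.coneFrom s (classPaths E i A)) →
      ∃ σ' : P.Scheduler, (σ'.measure r).real (P.coneFrom r (classPaths E i A)) ≥
        (σ.measure s).real (P.coneFrom s (classPaths E i A))) :
    P.maxProb s A ≤ P.maxProb r A := by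
  simp only [coneFrom_classPaths hE hA, measureReal_paths_inter] at h
  exact maxProb_le_of_dominates h

lemma IsDepthBisim.maxProb_eq {i : ℕ} (hi : 1 ≤ i) {prev R E : S → S → Prop}
    (h : P.IsDepthBisim i prev R) (hE : Equivalence E) (hRE : ∀ s r, R s r → E s r)
    {A : Set (ℕ → S)} (hA : InvariantUpTo E i A) {s r : S} (hsr : R s r) :
    P.maxProb s A = P.maxProb r A := by
  rcases A.eq_empty_or_nonempty with rfl | hne
  · simp [maxProb]
  have hsub := classPaths_subset h.preorder.refl hRE hE hi A
  have hgr := isGreatest_classPaths E i hne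
  exact (maxProb_le_of_forall_cone hE.refl hA (h.forth s r hsr _ hsub hgr)).antisymm
    (maxProb_le_of_forall_cone hE.refl hA (h.back s r hsr _ hsub hgr))

lemma InvariantUpTo.exists_measure_eq {E : S → S → Prop} (hE : Equivalence E) {A : Set (ℕ → S)}
    (hA : InvariantUpTo E 1 A) (s : S) :
    ∃ C : Set S, (∀ t t', E t t' → (t ∈ C ↔ t' ∈ C)) ∧
      ∀ r, E s r → ∀ σ : P.Scheduler, σ.measure r A = σ.measure r {ω | ω 1 ∈ C} := by
  refine ⟨{t | consPath s (fun _ => t) ∈ A}, fun t t' h => hA _ _ fun k _ => ?_,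
    fun r hsr σ => measure_congr ?_⟩
  · cases k with
    | zero => exact hE.refl _
    | succ k => exact h
  · filter_upwards [σ.ae_zero_eq r] with ω hω
    refine propext (hA _ _ fun k hk => ?_)
    interval_cases k
    · rw [hω]; exact hE.symm hsr
    · exact hE.refl _

lemma IsOneDepthBisim.maxProb_eq (serial : ∀ s, ∃ μ : PMF S, (s, μ) ∈ P.step)
    {R E : S → S → Prop} (h : P.IsOneDepthBisim R) (hE : Equivalence E)
    (hRE : ∀ s r, R s r → E s r) {A : Set (ℕ → S)} (hA : InvariantUpTo E 1 A) {s r : S}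
    (hsr : R s r) : P.maxProb s A = P.maxProb r A := by
  obtain ⟨C, hC, hAC⟩ := hA.exists_measure_eq (P := P) hE s
  have hdown := downClosed_of_saturated h.preorder.refl hRE hC
  have key {s' r' : S} (hs' : E s s') (hr' : E s r')
      (hstep : ∀ μ : PMF S, (s', μ) ∈ P.step → 0 < μ.toOuterMeasure C →
        ∃ μ' : PMF S, (r', μ') ∈ P.step ∧ μ'.toOuterMeasure C ≥ μ.toOuterMeasure C) :
      P.maxProb s' A ≤ P.maxProb r' A := by
    refine iSup_le fun σ => ?_
    rw [hAC s' hs' σ]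
    obtain ⟨μ, hμ, hle⟩ := σ.exists_step_measure_one_le s' C
    refine hle.trans ?_
    rcases eq_zero_or_pos (μ.toOuterMeasure C) with h0 | h0
    · rw [h0]; exact zero_le
    obtain ⟨μ', hμ', hge⟩ := hstep μ hμ h0
    obtain ⟨σ', hσ'⟩ := exists_scheduler_measure_one_eq serial hμ' C
    rw [← hσ', ← hAC r' hr' σ'] at hge
    exact hge.trans (measure_le_maxProb σ' r' A)
  exact (key (hE.refl s) (hRE s r hsr) (h.forth s r hsr C hdown)).antisymm
    (key (hRE s r hsr) (hE.refl s) (h.back s r hsr C hdown))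

lemma DepthBisimilar.label_eq {i : ℕ} {s r : S} (h : P.DepthBisimilar (i + 1) s r) :
    P.label s = P.label r := by
  induction i with
  | zero =>
    obtain ⟨R, hR, hsr⟩ := h
    exact hR.label_eq s r hsr
  | succ i ih =>
    obtain ⟨R, hR, hsr⟩ := h
    exact ih (hR.le_prev s r hsr)

theorem DepthBisimilar.equivFragment (serial : ∀ s, ∃ μ : PMF S, (s, μ) ∈ P.step) {i : ℕ}
    {s r : S} (h : P.DepthBisimilar (i + 1) s r) : P.EquivFragment (i + 1) s r := by
  let E := Relation.EqvGen (P.DepthBisimilar (i + 1))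
  have hE : Equivalence E := Relation.EqvGen.is_equivalence _
  have hlabel : ∀ s r, E s r → P.label s = P.label r := fun s r h => by
    induction h with
    | rel s r h => exact h.label_eq
    | refl s => rfl
    | symm s r _ ih => exact ih.symm
    | trans s r t _ _ ih₁ ih₂ => exact ih₁.trans ih₂
  have hmax : ∀ A, InvariantUpTo E (i + 1) A → ∀ s r, E s r → P.maxProb s A = P.maxProb r A :=
      fun A hA s r h => by
    induction h with
    | rel s r h =>
      cases i with
      | zero =>
        obtain ⟨R, hR, hsr⟩ := h
        exact hR.maxProb_eq serial hE (fun s r hsr => .rel _ _ ⟨R, hR, hsr⟩) hA hsr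
      | succ i =>
        obtain ⟨R, hR, hsr⟩ := h
        exact hR.maxProb_eq (by omega) hE (fun s r hsr => .rel _ _ ⟨R, hR, hsr⟩) hA hsr
    | refl s => rfl
    | symm s r _ ih => exact ih.symm
    | trans s r t _ _ ih₁ ih₂ => exact ih₁.trans ih₂
  exact fun φ hφ => sat_congr_of_inFragment serial hlabel hmax φ hφ s r (.rel _ _ h)

end Soundness

section Definability

lemma consPath_tail (ω : ℕ → S) : consPath (ω 0) (tail ω) = ω := by
  funext n
  cases n with
  | zero => rfl
  | succ n => simp [consPath, tail, add_comm]

lemma biInter_mem_of_boolean {X ι : Type*} {𝓓 : Set (Set X)} (hu : Set.univ ∈ 𝓓)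
    (hi : ∀ A ∈ 𝓓, ∀ B ∈ 𝓓, A ∩ B ∈ 𝓓) {D : ι → Set X} {F : Set ι} (hF : F.Finite)
    (hD : ∀ a ∈ F, D a ∈ 𝓓) : (⋂ a ∈ F, D a) ∈ 𝓓 := by
  induction F, hF using Set.Finite.induction_on with
  | empty => simpa using hu
  | insert _ _ ih =>
    rw [Set.biInter_insert]
    exact hi _ (hD _ (Set.mem_insert _ _)) _ (ih fun a ha => hD a (Set.mem_insert_of_mem _ ha))

lemma biUnion_mem_of_boolean {X ι : Type*} {𝓓 : Set (Set X)} (hu : Set.univ ∈ 𝓓)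
    (hc : ∀ A ∈ 𝓓, Aᶜ ∈ 𝓓) (hi : ∀ A ∈ 𝓓, ∀ B ∈ 𝓓, A ∩ B ∈ 𝓓) {D : ι → Set X} {F : Set ι}
    (hF : F.Finite) (hD : ∀ a ∈ F, D a ∈ 𝓓) : (⋃ a ∈ F, D a) ∈ 𝓓 := by
  have := hc _ (biInter_mem_of_boolean hu hi hF fun a ha => hc _ (hD a ha))
  simpa only [Set.compl_iInter, compl_compl] using this

mutual

theorem StateFormula.false_of_isEmpty {AP : Type v} [IsEmpty AP] (φ : StateFormula AP) : False := by
  match φ with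
  | .atom a => exact isEmptyElim a
  | .and φ₁ _ => exact StateFormula.false_of_isEmpty φ₁
  | .not φ => exact StateFormula.false_of_isEmpty φ
  | .prob _ _ ψ => exact PathFormula.false_of_isEmpty ψ

theorem PathFormula.false_of_isEmpty {AP : Type v} [IsEmpty AP] (ψ : PathFormula AP) : False := by
  match ψ with
  | .state φ => exact StateFormula.false_of_isEmpty φ
  | .and ψ₁ _ => exact PathFormula.false_of_isEmpty ψ₁
  | .not ψ => exact PathFormula.false_of_isEmpty ψ
  | .next ψ => exact PathFormula.false_of_isEmpty ψ
  | .until ψ₁ _ => exact PathFormula.false_of_isEmpty ψ₁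

end

variable [Fintype S] [MeasurableSpace S] [DiscreteMeasurableSpace S] {P : ProbAutomaton S AP}

lemma equivalence_equivFragment (P : ProbAutomaton S AP) (i : ℕ) :
    Equivalence (P.EquivFragment i) where
  refl _ _ _ := Iff.rfl
  symm h φ hφ := (h φ hφ).symm
  trans h h' φ hφ := (h φ hφ).trans (h' φ hφ)

/-- The sets of states that are defined by a state formula of depth `i`. -/
def stateDefinable (P : ProbAutomaton S AP) (i : ℕ) : Set (Set S) :=
  {C | ∃ φ : StateFormula AP, φ.InFragment i ∧ {s | P.Sat φ s} = C}

/-- The sets of sequences that are defined by a path formula of depth at most `n` whose state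
subformulae have depth `i`. -/
def pathDefinable (P : ProbAutomaton S AP) (i n : ℕ) : Set (Set (ℕ → S)) :=
  {A | ∃ ψ : PathFormula AP, ψ.InFragment i ∧ ψ.depth ≤ n ∧ {ω | P.PathSat ψ ω} = A}

lemma compl_mem_stateDefinable {i : ℕ} : ∀ C ∈ P.stateDefinable i, Cᶜ ∈ P.stateDefinable i := by
  rintro _ ⟨φ, hφ, rfl⟩
  exact ⟨.not φ, by simpa only [StateFormula.InFragment], by simp only [Sat]; rfl⟩

lemma inter_mem_stateDefinable {i : ℕ} : ∀ C ∈ P.stateDefinable i, ∀ D ∈ P.stateDefinable i,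
    C ∩ D ∈ P.stateDefinable i := by
  rintro _ ⟨φ, hφ, rfl⟩ _ ⟨φ', hφ', rfl⟩
  exact ⟨.and φ φ', by simp only [StateFormula.InFragment]; exact ⟨hφ, hφ'⟩,
    by simp only [Sat]; rfl⟩

lemma univ_mem_stateDefinable [Nonempty AP] {i : ℕ} : Set.univ ∈ P.stateDefinable i := by
  obtain ⟨a⟩ := ‹Nonempty AP›
  have h : {s | P.Sat (.atom a) s} ∈ P.stateDefinable i :=
    ⟨.atom a, by simp only [StateFormula.InFragment], rfl⟩
  have := compl_mem_stateDefinable _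
    (inter_mem_stateDefinable _ h _ (compl_mem_stateDefinable _ h))
  rwa [Set.inter_compl_self, Set.compl_empty] at this

lemma mem_stateDefinable_of_saturated [Nonempty AP] {i : ℕ} {C : Set S}
    (hC : ∀ s r, P.EquivFragment i s r → (s ∈ C ↔ r ∈ C)) : C ∈ P.stateDefinable i := by
  have hsep (s r : S) (hs : s ∈ C) (hr : r ∈ Cᶜ) :
      ∃ D ∈ P.stateDefinable i, s ∈ D ∧ r ∉ D := by
    by_contra! h
    refine hr ((hC s r fun φ hφ => ?_).1 hs)
    by_cases hsφ : P.Sat φ s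
    · exact iff_of_true hsφ (h _ ⟨φ, hφ, rfl⟩ hsφ)
    · refine iff_of_false hsφ fun hrφ => ?_
      exact h _ (compl_mem_stateDefinable _ ⟨φ, hφ, rfl⟩) hsφ hrφ
  choose! D hD hsD hrD using hsep
  have : C = ⋃ s ∈ C, ⋂ r ∈ Cᶜ, D s r := by
    ext t
    simp only [Set.mem_iUnion, Set.mem_iInter, exists_prop]
    refine ⟨fun ht => ⟨t, ht, fun r hr => hsD t r ht hr⟩, fun ⟨s, hs, h⟩ => ?_⟩
    by_contra ht
    exact hrD s t hs ht (h t ht)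
  rw [this]
  exact biUnion_mem_of_boolean univ_mem_stateDefinable compl_mem_stateDefinable
    inter_mem_stateDefinable (Set.toFinite _) fun s hs =>
      biInter_mem_of_boolean univ_mem_stateDefinable inter_mem_stateDefinable (Set.toFinite _)
        fun r hr => hD s r hs hr

lemma zero_mem_pathDefinable {i n : ℕ} {C : Set S} (hC : C ∈ P.stateDefinable i) :
    {ω | ω 0 ∈ C} ∈ P.pathDefinable i n := by
  obtain ⟨φ, hφ, rfl⟩ := hC
  exact ⟨.state φ, by simpa only [PathFormula.InFragment], by simp [PathFormula.depth],
    by simp only [PathSat]; rfl⟩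

lemma compl_mem_pathDefinable {i n : ℕ} :
    ∀ A ∈ P.pathDefinable i n, Aᶜ ∈ P.pathDefinable i n := by
  rintro _ ⟨ψ, hψ, hd, rfl⟩
  exact ⟨.not ψ, by simpa only [PathFormula.InFragment], by simpa only [PathFormula.depth],
    by simp only [PathSat]; rfl⟩

lemma inter_mem_pathDefinable {i n : ℕ} : ∀ A ∈ P.pathDefinable i n, ∀ B ∈ P.pathDefinable i n,
    A ∩ B ∈ P.pathDefinable i n := by
  rintro _ ⟨ψ, hψ, hd, rfl⟩ _ ⟨ψ', hψ', hd', rfl⟩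
  exact ⟨.and ψ ψ', by simp only [PathFormula.InFragment]; exact ⟨hψ, hψ'⟩,
    by simp only [PathFormula.depth]; exact max_le hd hd', by simp only [PathSat]; rfl⟩

lemma next_mem_pathDefinable {i n : ℕ} {A : Set (ℕ → S)} (hA : A ∈ P.pathDefinable i n) :
    {ω | tail ω ∈ A} ∈ P.pathDefinable i (n + 1) := by
  obtain ⟨ψ, hψ, hd, rfl⟩ := hA
  exact ⟨.next ψ, by simpa only [PathFormula.InFragment],
    by simp only [PathFormula.depth]; omega, by simp only [PathSat]; rfl⟩

lemma InvariantUpTo.mem_pathDefinable [Nonempty AP] {i n : ℕ} {A : Set (ℕ → S)}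
    (hA : InvariantUpTo (P.EquivFragment i) n A) : A ∈ P.pathDefinable i n := by
  have hE := P.equivalence_equivFragment i
  induction n generalizing A with
  | zero =>
    have : A = {ω : ℕ → S | ω 0 ∈ {s | (fun _ => s) ∈ A}} := by
      ext ω
      refine hA _ _ fun k hk => ?_
      rw [Nat.le_zero.1 hk]
      exact hE.refl _
    rw [this]
    exact zero_mem_pathDefinable (mem_stateDefinable_of_saturated fun s r hsr =>
      hA _ _ fun _ _ => hsr)
  | succ n ih =>
    have : A = ⋃ s ∈ (Set.univ : Set S), {ω | ω 0 ∈ {r | P.EquivFragment i s r}} ∩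
        {ω | tail ω ∈ {ω | consPath s ω ∈ A}} := by
      ext ω
      simp only [Set.mem_iUnion, Set.mem_univ, exists_true_left]
      constructor
      · intro hω
        refine ⟨ω 0, hE.refl _, ?_⟩
        change consPath (ω 0) (tail ω) ∈ A
        rwa [consPath_tail]
      · rintro ⟨s, hs, hω⟩
        refine (hA (consPath s (tail ω)) ω fun k _ => ?_).1 hω
        cases k with
        | zero => exact hs
        | succ k =>
          have : consPath s (tail ω) (k + 1) = ω (k + 1) := by simp [consPath, tail, add_comm]
          rw [this]
          exact hE.refl _
    have huniv : Set.univ ∈ P.pathDefinable i (n + 1) :=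
      zero_mem_pathDefinable univ_mem_stateDefinable
    rw [this]
    refine biUnion_mem_of_boolean huniv compl_mem_pathDefinable inter_mem_pathDefinable
      Set.finite_univ fun s _ => inter_mem_pathDefinable _ (zero_mem_pathDefinable
        (mem_stateDefinable_of_saturated fun r r' h =>
          ⟨fun h' => hE.trans h' h, fun h' => hE.trans h' (hE.symm h)⟩)) _
        (next_mem_pathDefinable (ih fun ω ω' h => hA _ _ fun k hk => ?_))
    cases k with
    | zero => exact hE.refl _
    | succ k => exact h k (by omega)

end Definability

section Completeness

variable [Fintype S] [MeasurableSpace S] [DiscreteMeasurableSpace S] {P : ProbAutomaton S AP}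
  (serial : ∀ s, ∃ μ : PMF S, (s, μ) ∈ P.step)
include serial

lemma EquivFragment.maxProb_eq {i : ℕ} {A : Set (ℕ → S)}
    (hA : InvariantUpTo (P.EquivFragment i) i A) {s r : S} (h : P.EquivFragment i s r) :
    P.maxProb s A = P.maxProb r A := by
  cases isEmpty_or_nonempty AP with
  | inl _ =>
    have : A = ∅ ∨ A = Set.univ := by
      refine A.eq_empty_or_nonempty.imp_right fun ⟨ω, hω⟩ => Set.eq_univ_of_forall fun ω' => ?_
      exact (hA ω ω' fun k _ φ => (StateFormula.false_of_isEmpty φ).elim).1 hω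
    rcases this with rfl | rfl <;> simp [maxProb]
  | inr _ =>
    obtain ⟨ψ, hψ, hd, rfl⟩ := hA.mem_pathDefinable
    exact maxProb_eq_of_sat serial fun q =>
      h (.prob .le q ψ) (by simp only [StateFormula.InFragment]; exact ⟨hd, hψ⟩)

omit serial in
lemma EquivFragment.label_eq {i : ℕ} {s r : S} (h : P.EquivFragment i s r) :
    P.label s = P.label r := by
  ext a
  have := h (.atom a) (by simp only [StateFormula.InFragment])
  simpa only [Sat] using this

omit serial in
lemma DownClosed.mem_iff_of_equivFragment {i : ℕ} {C : Set S}
    (hC : DownClosed (P.EquivFragment i) C) {s r : S} (h : P.EquivFragment i s r) :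
    s ∈ C ↔ r ∈ C := by
  have hE := P.equivalence_equivFragment i
  constructor
  · intro hs; rw [hC]; exact ⟨s, hs, hE.symm h⟩
  · intro hr; rw [hC]; exact ⟨r, hr, h⟩

lemma isOneDepthBisim_equivFragment : P.IsOneDepthBisim (P.EquivFragment 1) := by
  have hE := P.equivalence_equivFragment 1
  have key (s r : S) (h : P.EquivFragment 1 s r) (C : Set S)
      (hC : DownClosed (P.EquivFragment 1) C) (μ : PMF S) (hμ : (s, μ) ∈ P.step) :
      ∃ μ' : PMF S, (r, μ') ∈ P.step ∧ μ'.toOuterMeasure C ≥ μ.toOuterMeasure C := by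
    have hA : InvariantUpTo (P.EquivFragment 1) 1 {ω : ℕ → S | ω 1 ∈ C} := fun ω ω' hω =>
      hC.mem_iff_of_equivFragment (hω 1 le_rfl)
    obtain ⟨σ, hσ⟩ := exists_scheduler_measure_one_eq serial hμ C
    have hrec : Recognizable {ω : ℕ → S | ω 1 ∈ C} :=
      (hA.mono (R' := (· = ·)) (fun s r h => h ▸ hE.refl s) le_rfl).recognizable
    obtain ⟨σ', hσ'⟩ := hrec.exists_measure_eq_maxProb serial r
    obtain ⟨μ', hμ', hle⟩ := σ'.exists_step_measure_one_le r C
    refine ⟨μ', hμ', ?_⟩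
    rw [hσ', ← EquivFragment.maxProb_eq serial hA h] at hle
    rw [← hσ]
    exact (measure_le_maxProb σ s _).trans hle
  exact ⟨{ refl := hE.refl, trans := fun _ _ _ => hE.trans }, fun s r h => h.label_eq,
    fun s r h C hC μ hμ _ => key s r h C hC μ hμ,
    fun s r h C hC μ hμ _ => key r s (hE.symm h) C hC μ hμ⟩

lemma isDepthBisim_equivFragment {i : ℕ} {prev : S → S → Prop}
    (hprev : ∀ s r, P.EquivFragment i s r → prev s r) :
    P.IsDepthBisim i prev (P.EquivFragment i) := by
  have hE := P.equivalence_equivFragment i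
  have key (s r : S) (h : P.EquivFragment i s r) (Ωs : Set (SetPath S))
      (hΩ : Ωs ⊆ closedSetPaths (P.EquivFragment i)) (hgr : IsGreatest (Sigma.fst '' Ωs) i)
      (σ : P.Scheduler) : ∃ σ' : P.Scheduler,
        (σ'.measure r).real (P.coneFrom r Ωs) ≥ (σ.measure s).real (P.coneFrom s Ωs) := by
    set A : Set (ℕ → S) := {ω | ∃ Ω ∈ Ωs, ∀ k : Fin (Ω.1 + 1), ω k ∈ Ω.2 k}
    have hcone (s : S) : P.coneFrom s Ωs = {ω | ω ∈ P.paths s ∧ ω ∈ A} := rfl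
    have hA : InvariantUpTo (P.EquivFragment i) i A := fun ω ω' hω =>
      exists_congr fun Ω => and_congr_right fun hΩs => forall_congr' fun k =>
        ((hΩ hΩs).2 k).mem_iff_of_equivFragment
          (hω k ((Nat.le_of_lt_succ k.2).trans (hgr.2 ⟨Ω, hΩs, rfl⟩)))
    have hrec : Recognizable A := (hA.mono (R' := (· = ·)) (fun s r h => h ▸ hE.refl s) le_rfl).recognizable
    obtain ⟨σ', hσ'⟩ := hrec.exists_measureReal_eq serial r
    refine ⟨σ', ?_⟩
    rw [hcone, hcone, measureReal_paths_inter, measureReal_paths_inter, hσ',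
      ← EquivFragment.maxProb_eq serial hA h]
    exact measureReal_le_maxProb σ s A
  exact ⟨{ refl := hE.refl, trans := fun _ _ _ => hE.trans }, hprev,
    fun s r h Ωs hΩ hgr σ _ => key s r h Ωs hΩ hgr σ,
    fun s r h Ωs hΩ hgr σ _ => key r s (hE.symm h) Ωs hΩ hgr σ⟩

end Completeness

mutual

theorem StateFormula.InFragment.mono {AP : Type v} {i j : ℕ} (hij : i ≤ j) (φ : StateFormula AP)
    (h : φ.InFragment i) : φ.InFragment j := by
  match φ with
  | .atom a => simp only [StateFormula.InFragment]
  | .and φ₁ φ₂ =>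
    simp only [StateFormula.InFragment] at h ⊢
    exact ⟨StateFormula.InFragment.mono hij φ₁ h.1, StateFormula.InFragment.mono hij φ₂ h.2⟩
  | .not φ =>
    simp only [StateFormula.InFragment] at h ⊢
    exact StateFormula.InFragment.mono hij φ h
  | .prob c q ψ =>
    simp only [StateFormula.InFragment] at h ⊢
    exact ⟨h.1.trans hij, PathFormula.InFragment.mono hij ψ h.2⟩

theorem PathFormula.InFragment.mono {AP : Type v} {i j : ℕ} (hij : i ≤ j) (ψ : PathFormula AP)
    (h : ψ.InFragment i) : ψ.InFragment j := by
  match ψ with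
  | .state φ =>
    simp only [PathFormula.InFragment] at h ⊢
    exact StateFormula.InFragment.mono hij φ h
  | .and ψ₁ ψ₂ =>
    simp only [PathFormula.InFragment] at h ⊢
    exact ⟨PathFormula.InFragment.mono hij ψ₁ h.1, PathFormula.InFragment.mono hij ψ₂ h.2⟩
  | .not ψ =>
    simp only [PathFormula.InFragment] at h ⊢
    exact PathFormula.InFragment.mono hij ψ h
  | .next ψ =>
    simp only [PathFormula.InFragment] at h ⊢
    exact PathFormula.InFragment.mono hij ψ h
  | .until ψ₁ ψ₂ => simp only [PathFormula.InFragment] at h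

end

section FragmentTheorem

variable [Fintype S] [MeasurableSpace S] [DiscreteMeasurableSpace S] {P : ProbAutomaton S AP}

lemma EquivFragment.anti {i j : ℕ} (hij : i ≤ j) {s r : S} (h : P.EquivFragment j s r) :
    P.EquivFragment i s r :=
  fun φ hφ => h φ (StateFormula.InFragment.mono hij φ hφ)

theorem EquivFragment.depthBisimilar (serial : ∀ s, ∃ μ : PMF S, (s, μ) ∈ P.step) {i : ℕ}
    {s r : S} (h : P.EquivFragment (i + 1) s r) : P.DepthBisimilar (i + 1) s r := by
  induction i generalizing s r with
  | zero => exact ⟨_, isOneDepthBisim_equivFragment serial, h⟩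
  | succ i ih =>
    exact ⟨_, isDepthBisim_equivFragment serial fun s r h => ih (h.anti (Nat.le_succ _)), h⟩

/-- Equivalence for all fragments is equivalence for a single one. -/
lemma exists_forall_equivFragment (P : ProbAutomaton S AP) :
    ∃ m, ∀ s r, P.EquivFragment m s r → ∀ i, P.EquivFragment i s r := by
  have h (p : S × S) : ∃ n, P.EquivFragment n p.1 p.2 → ∀ i, P.EquivFragment i p.1 p.2 := by
    by_cases hp : ∀ i, P.EquivFragment i p.1 p.2
    · exact ⟨0, fun _ => hp⟩
    · push Not at hp
      exact hp.imp fun n hn hn' => absurd hn' hn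
  choose n hn using h
  exact ⟨Finset.univ.sup n, fun s r hsr => hn (s, r)
    (hsr.anti (Finset.le_sup (f := n) (Finset.mem_univ (s, r))))⟩

end FragmentTheorem

section Limit

variable [Fintype S] {P : ProbAutomaton S AP}

/-- Certificates for a decreasing sequence of events of finite depth have a limit, which is a
certificate for the intersection. -/
lemma exists_isCertificate_iInter {s : S} {K : ℕ → Set (ℕ → S)} (hanti : Antitone K)
    (hK : ∀ n, InvariantUpTo (· = ·) n (K n)) {c : ℝ} {g : ℕ → List S → ℝ}
    {act : ℕ → List S → PMF S} (hcert : ∀ n, P.IsCertificate s (K n) (g n) (act n))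
    (hc : ∀ n, c ≤ g n [])
    (hpos : ∀ n w, 0 < g n w → ∃ ω ∈ K n, ω 0 = s ∧ word ω w.length = w) :
    ∃ g' act', P.IsCertificate s (⋂ n, K n) g' act' ∧ c ≤ g' [] := by
  let U : Ultrafilter ℕ := hyperfilter ℕ
  have hg (w : List S) : ∃ x ∈ Set.Icc (0 : ℝ) 1, Tendsto (fun n => g n w) U (nhds x) :=
    isCompact_Icc.ultrafilter_le_nhds (U.map fun n => g n w) (le_principal_iff.2
      (mem_map.2 (univ_mem' fun n => ⟨(hcert n).nonneg w, (hcert n).le_one w⟩)))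
  choose g' hg' hlim using hg
  have hact (w : List S) : ∃ μ : PMF S, ((s :: w).getLast (List.cons_ne_nil _ _), μ) ∈ P.step ∧
      ∀ᶠ n in (U : Filter ℕ), act n w = μ := by
    obtain ⟨μ, hμ, h⟩ := Ultrafilter.eq_pure_of_finite_mem (f := U.map fun n => act n w)
      (P.imageFinite ((s :: w).getLast (List.cons_ne_nil _ _)))
      (Ultrafilter.mem_map.2 (univ_mem' fun n => (hcert n).step w))
    refine ⟨μ, hμ, ?_⟩
    have : ({μ} : Set (PMF S)) ∈ U.map fun n => act n w := by rw [h]; exact Set.mem_singleton μ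
    exact this
  choose act' hstep hact' using hact
  refine ⟨g', act', ⟨fun w => (hg' w).1, fun w => (hg' w).2, hstep, fun w => ?_,
    fun ω hω hf => Set.mem_iInter.2 fun k => ?_⟩,
    ge_of_tendsto (hlim []) (Eventually.of_forall hc)⟩
  · refine le_of_tendsto_of_tendsto (hlim w)
      (tendsto_finsetSum _ fun t _ => (hlim (w ++ [t])).const_mul (act' w t).toReal) ?_
    filter_upwards [hact' w] with n hn
    rw [← hn]
    exact (hcert n).le_sum w
  · obtain ⟨m, hm, hmpos⟩ := frequently_atTop.1 hf k
    obtain ⟨n, hn, hnk⟩ := (((hlim (word ω m)).eventually_const_lt hmpos).and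
      (Nat.hyperfilter_le_atTop (eventually_ge_atTop k))).exists
    obtain ⟨ω', h1, h2, h3⟩ := hpos n _ hn
    rw [length_word] at h3
    refine (hK k ω' ω fun j hj => ?_).1 (hanti hnk h1)
    cases j with
    | zero => rw [h2, hω]
    | succ j => exact word_eq_word_iff.1 h3 j (by omega)

variable [MeasurableSpace S] [DiscreteMeasurableSpace S]

/-- Maximal probabilities of invariant events are determined by those of the invariant events of
finite depth. -/
lemma maxProb_le_of_invariantUnder (serial : ∀ s, ∃ μ : PMF S, (s, μ) ∈ P.step)
    {E : S → S → Prop} (hE : Equivalence E) {s r : S}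
    (hmax : ∀ n A, InvariantUpTo E n A → P.maxProb s A = P.maxProb r A) {A : Set (ℕ → S)}
    (hA : InvariantUnder E A) (hrec : Recognizable A) : P.maxProb s A ≤ P.maxProb r A := by
  refine le_of_not_gt fun hlt => ?_
  obtain ⟨c, hrc, hcs⟩ := ENNReal.lt_iff_exists_nnreal_btwn.1 hlt
  obtain ⟨σ, hσ⟩ := lt_iSup_iff.1 hcs
  let q (s : S) : S := (Quotient.mk ⟨E, hE⟩ s).out
  have hq (s : S) : E (q s) s := Quotient.mk_out (s := ⟨E, hE⟩) s
  have hqE {s r : S} (h : E s r) : q s = q r :=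
    congrArg Quotient.out (Quotient.sound (s := ⟨E, hE⟩) h)
  let ρ (ω : ℕ → S) : ℕ → S := fun k => q (ω k)
  have hρ : Measurable ρ :=
    measurable_pi_lambda _ fun k => (Measurable.of_discrete (f := q)).comp (measurable_pi_apply k)
  have hAρ : ρ ⁻¹' A = A := Set.ext fun ω => hA _ _ fun k => hq (ω k)
  have : IsProbabilityMeasure ((σ.measure s).map ρ) :=
    Measure.isProbabilityMeasure_map hρ.aemeasurable
  obtain ⟨K₀, hK₀A, hK₀m, hcK₀, hK₀⟩ := exists_prefixClosed_lt ((σ.measure s).map ρ)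
    hrec.measurableSet (c := c) (by rwa [Measure.map_apply hρ hrec.measurableSet, hAρ])
  rw [Measure.map_apply hρ hK₀m] at hcK₀
  let K (n : ℕ) : Set (ℕ → S) := {ω | ∃ ω' ∈ K₀, ∀ k ≤ n, ω' k = q (ω k)}
  have hanti : Antitone K := fun m n hmn ω ⟨ω', h, h'⟩ => ⟨ω', h, fun k hk => h' k (hk.trans hmn)⟩
  have hKinv (n : ℕ) : InvariantUpTo E n (K n) := fun ω ω' hω =>
    exists_congr fun x => and_congr_right fun _ => forall₂_congr fun k hk => by rw [hqE (hω k hk)]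
  have hKeq (n : ℕ) : InvariantUpTo (· = ·) n (K n) :=
    (hKinv n).mono (fun s r h => h ▸ hE.refl s) le_rfl
  have hKA : ⋂ n, K n ⊆ A := fun ω hω => by
    rw [← hAρ]
    exact hK₀A (hK₀ (ρ ω) fun n => Set.mem_iInter.1 hω n)
  have hcert (n : ℕ) : ∃ g act, P.IsCertificate r (K n) g act ∧ (c : ℝ) < g [] ∧
      ∀ w, 0 < g w → ∃ ω ∈ K n, ω 0 = r ∧ word ω w.length = w := by
    have h1 : (c : ENNReal) < P.maxProb r (K n) := by
      rw [← hmax n _ (hKinv n)]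
      refine (hcK₀.trans_le (measure_mono fun ω hω => ?_)).trans_le (measure_le_maxProb σ s (K n))
      exact ⟨ρ ω, hω, fun k _ => rfl⟩
    obtain ⟨σ', hσ'⟩ := lt_iSup_iff.1 h1
    exact exists_isCertificate_of_lt serial σ' r (hKeq n).recognizable.measurableSet c.2
      (by rwa [ENNReal.ofReal_coe_nnreal])
  choose g act hcert hg hpos using hcert
  obtain ⟨g', act', hcert', hg'⟩ :=
    exists_isCertificate_iInter hanti hKeq hcert (fun n => (hg n).le) hpos
  obtain ⟨σ', hσ'⟩ := hrec.exists_scheduler serial r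
  have h1 : (c : ENNReal) ≤ P.maxProb r A := by
    rw [← ENNReal.ofReal_coe_nnreal]
    exact (ENNReal.ofReal_le_ofReal (hg'.trans (hcert'.mono hKA).le_certValue)).trans
      (hσ'.trans (measure_le_maxProb σ' r A))
  exact h1.not_gt hrc

theorem equivPCTLStar_of_forall_equivFragment (serial : ∀ s, ∃ μ : PMF S, (s, μ) ∈ P.step)
    {s r : S} (h : ∀ i, P.EquivFragment i s r) : P.EquivPCTLStar s r := by
  obtain ⟨m, hm⟩ := exists_forall_equivFragment P
  have hE := P.equivalence_equivFragment m
  have hmax : ∀ n A, InvariantUpTo (P.EquivFragment m) n A → ∀ s r, P.EquivFragment m s r →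
      P.maxProb s A = P.maxProb r A := fun n A hA s r hsr =>
    (hm s r hsr (max m n)).maxProb_eq serial
      (hA.mono (fun _ _ h => h.anti (le_max_left m n)) (le_max_right m n))
  intro φ
  refine sat_congr serial (R := P.EquivFragment m) (fun s r h => h.label_eq)
    (fun A hrec hA s r hsr => ?_) φ s r (h m)
  exact (maxProb_le_of_invariantUnder serial hE (fun n A hA => hmax n A hA s r hsr) hA
    hrec).antisymm (maxProb_le_of_invariantUnder serial hE
      (fun n A hA => (hmax n A hA s r hsr).symm) hA hrec)

end Limit

end ProbAutomaton

end

theorem mainTheorem1 {S : Type u} {AP : Type v}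
    [Finite S] [MeasurableSpace S] [DiscreteMeasurableSpace S]
    (P : ProbAutomaton S AP) (serial : ∀ s, ∃ μ : PMF S, (s, μ) ∈ P.step) :
    (∀ i ≥ 1, ∀ s r : S, P.EquivFragment i s r ↔ P.DepthBisimilar i s r) ∧
      (∀ s r : S, P.EquivPCTLStar s r ↔ P.StrongBisimilar s r) := by
  cases nonempty_fintype S
  have hfrag : ∀ i ≥ 1, ∀ s r : S, P.EquivFragment i s r ↔ P.DepthBisimilar i s r := by
    intro i hi s r
    obtain ⟨i, rfl⟩ := Nat.exists_eq_succ_of_ne_zero (Nat.one_le_iff_ne_zero.1 hi)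
    exact ⟨fun h => h.depthBisimilar serial, fun h => h.equivFragment serial⟩
  refine ⟨hfrag, fun s r => ⟨fun h i hi => (hfrag i hi s r).1 fun φ _ => h φ, fun h => ?_⟩⟩
  exact P.equivPCTLStar_of_forall_equivFragment serial fun i =>
    ((hfrag (i + 1) (Nat.le_add_left 1 i) s r).2 (h _ (Nat.le_add_left 1 i))).anti
      (Nat.le_succ i)
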